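/- For every $\lambda\in\mathbb{C}$ the modified Mathieu equation $$-\psi''(x)+2\cosh(2x)\,\psi(x)=\lambda\,\psi(x),\qquad -\infty<x<\infty,$$ has a solution $\psi_1(x,\lambda)$ such that, for every $k\in\mathbb{C}$ with $k^2=\lambda$, $$\psi_1(x,\lambda)=K_{ik}(e^{x})\,(1+o(1))\quad\text{as } x\to\infty,$$ where $K_\nu(z)=\int_0^\infty e^{-z\cosh t}\cosh(\nu t)\,dt$ $(z>0,\ \nu\in\mathbb{C})$ is the modified Bessel function of the second kind. Moreover, for every real $a$ there is a constant $C$, depending on $a$ and $\lambda$, such that $$|\psi_1(x,\lambda)-K_{ik}(e^{x})|\le C\,e^{-e^{x}}\,e^{-\frac72 x}\qquad\text{for all } x\ge a .$$ For every fixed $x\in\mathbb{R}$, the function $\lambda\mapsto\psi_1(x,\lambda)$ is an entire function of order $1/2$. -/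

import Mathlib

noncomputable section

/-- The modified Bessel function of the second kind `K_ν(z)` of complex order `ν` and positive
argument `z`, by its standard integral representation
`K_ν(z) = ∫_0^∞ exp(-z cosh t) cosh(ν t) dt`, which converges absolutely for every complex `ν`
and every `z > 0`. -/
def besselK (ν : ℂ) (z : ℝ) : ℂ :=
  ∫ t in Set.Ioi (0 : ℝ), (Real.exp (-(z * Real.cosh t)) : ℂ) * Complex.cosh (ν * (t : ℂ))

/-- `u` is a (classical, twice continuously differentiable) solution on the whole real line of the
modified Mathieu equation `-u'' + 2 cosh(2x) u = lam u` with complex spectral parameter `lam`. -/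
def IsModifiedMathieuSolution (lam : ℂ) (u : ℝ → ℂ) : Prop :=
  ContDiff ℝ 2 u ∧
    ∀ x : ℝ, -(deriv (deriv u) x) + ((2 * Real.cosh (2 * x) : ℝ) : ℂ) * u x = lam * u x

/-- `f` is an entire function of (finite) order `ρ`: it is holomorphic on `ℂ`, and `ρ` is the
infimum of the exponents `s ≥ 0` with `f(z) = O(exp(|z|^s))` as `|z| → ∞`. If there is no such
exponent (infinite order), no real number `ρ` satisfies this. -/
def IsEntireOfOrder (f : ℂ → ℂ) (ρ : ℝ) : Prop :=
  Differentiable ℂ f ∧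
    IsGLB {s : ℝ | 0 ≤ s ∧
      Asymptotics.IsBigO (Bornology.cobounded ℂ) f (fun z : ℂ => Real.exp (‖z‖ ^ s))} ρ

end

noncomputable section

open Set Filter Topology MeasureTheory

/-! Put $y=e^{-x}$ and write $\psi=\sqrt{\pi/2}\,e^{-e^x}e^{-x/2}\,w(y)$. The Mathieu equation
becomes $(y^2e^{-2/y}w')'=e^{-2/y}q\,w$ with $q(y)=y^2-\tfrac14-\lambda$. Integrating twice from
$y=0$, that is from $x=+\infty$, turns it into $w=1+Vqw$, where $V$ is a Volterra operator whose
kernel lies in $[0,\tfrac12]$ despite the irregular singular point. The Neumann series of this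
equation defines $\psi_1$.

The Bessel function $K_\nu(e^x)$ has the same form with the constant potential $\nu^2-\tfrac14$
(`besselRatio_eq_neumannSum`): the integral representation supplies the differential equation, the
vanishing of the flux $y^2e^{-2/y}v'$ at $0$, and the limit $\sqrt{\pi/2}$ by Laplace's method. For
$\nu=ik$ the two potentials differ by exactly $y^2$, so the two sums differ by $O(y^3)$
(`exists_norm_neumannSum_sub_le`). Multiplied by $e^{-e^x}e^{-x/2}$, this is the stated error; the
equivalence follows because $w$ stays away from $0$ near $y=0$.

Every term of the series is a polynomial in $\lambda$ and convergence is locally uniform, so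
$\psi_1$ is entire in $\lambda$. For the order, positivity of the kernel makes the series monotone
in the potential (`norm_neumannSum_le`), so $\psi_1$ can be compared with $K_n(e^x)$, $n\in\mathbb
N$. If $n^2$ slightly exceeds $|\lambda|$, then $|\psi_1|\le K_n=e^{O(n\log n)}$; at $\lambda=-n^2$,
$|\psi_1|\ge K_n\ge c\,e^n$. With $n\approx\sqrt{|\lambda|}$ these bounds pin the order to $1/2$. -/

/-! ### The Volterra operator attached to the irregular singular point -/

/-- Functions on the half-line that are continuous on `(0, ∞)` and bounded near `0`. -/
structure Admissible (f : ℝ → ℂ) : Prop where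
  cont : ContinuousOn f (Ioi 0)
  bdd : ∀ Y : ℝ, ∃ C : ℝ, 0 ≤ C ∧ ∀ s ∈ Ioc 0 Y, ‖f s‖ ≤ C

namespace Admissible

theorem of_continuous {f : ℝ → ℂ} (hf : Continuous f) : Admissible f := by
  refine ⟨hf.continuousOn, fun Y => ?_⟩
  obtain ⟨C, hC⟩ := (isCompact_Icc (a := (0 : ℝ)) (b := Y)).exists_bound_of_continuousOn
    hf.continuousOn
  exact ⟨max C 0, le_max_right _ _, fun s hs => (hC s (Ioc_subset_Icc_self hs)).trans
    (le_max_left _ _)⟩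

theorem const (c : ℂ) : Admissible (fun _ => c) := of_continuous continuous_const

theorem add {f g : ℝ → ℂ} (hf : Admissible f) (hg : Admissible g) :
    Admissible (fun s => f s + g s) := by
  refine ⟨hf.cont.add hg.cont, fun Y => ?_⟩
  obtain ⟨C, hC, h⟩ := hf.bdd Y
  obtain ⟨D, hD, h'⟩ := hg.bdd Y
  exact ⟨C + D, by positivity, fun s hs => norm_add_le_of_le (h s hs) (h' s hs)⟩

theorem mul {f g : ℝ → ℂ} (hf : Admissible f) (hg : Admissible g) :
    Admissible (fun s => f s * g s) := by
  refine ⟨hf.cont.mul hg.cont, fun Y => ?_⟩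
  obtain ⟨C, hC, h⟩ := hf.bdd Y
  obtain ⟨D, hD, h'⟩ := hg.bdd Y
  refine ⟨C * D, by positivity, fun s hs => ?_⟩
  rw [norm_mul]
  exact mul_le_mul (h s hs) (h' s hs) (norm_nonneg _) hC

theorem sub {f g : ℝ → ℂ} (hf : Admissible f) (hg : Admissible g) :
    Admissible (fun s => f s - g s) := by
  simpa [sub_eq_add_neg] using hf.add ((const (-1)).mul hg)

theorem congr {f g : ℝ → ℂ} (hf : Admissible f) (h : ∀ s, 0 < s → g s = f s) :
    Admissible g := by
  refine ⟨hf.cont.congr fun s hs => h s hs, fun Y => ?_⟩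
  obtain ⟨C, hC, h'⟩ := hf.bdd Y
  exact ⟨C, hC, fun s hs => by rw [h s hs.1]; exact h' s hs⟩

theorem exp_neg_two_div : Admissible (fun s => ((Real.exp (-2 / s) : ℝ) : ℂ)) := by
  refine ⟨?_, fun Y => ⟨1, zero_le_one, fun s hs => ?_⟩⟩
  · refine Complex.continuous_ofReal.comp_continuousOn (Real.continuous_exp.comp_continuousOn ?_)
    exact continuousOn_const.div continuousOn_id fun s hs => ne_of_gt hs
  · rw [Complex.norm_real, Real.norm_of_nonneg (Real.exp_pos _).le, Real.exp_le_one_iff]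
    exact div_nonpos_of_nonpos_of_nonneg (by norm_num) hs.1.le

theorem integrableOn {f : ℝ → ℂ} (hf : Admissible f) (y : ℝ) : IntegrableOn f (Ioc 0 y) := by
  obtain ⟨C, _, h⟩ := hf.bdd y
  refine Integrable.of_bound
    ((hf.cont.mono Ioc_subset_Ioi_self).aestronglyMeasurable measurableSet_Ioc) C ?_
  exact (ae_restrict_iff' measurableSet_Ioc).2 (Eventually.of_forall fun s hs => h s hs)

theorem intervalIntegrable {f : ℝ → ℂ} (hf : Admissible f) {y : ℝ} (hy : 0 ≤ y) :
    IntervalIntegrable f volume 0 y :=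
  (intervalIntegrable_iff_integrableOn_Ioc_of_le hy).2 (hf.integrableOn y)

theorem hasDerivAt_integral {f : ℝ → ℂ} (hf : Admissible f) {y : ℝ} (hy : 0 < y) :
    HasDerivAt (fun u => ∫ s in (0 : ℝ)..u, f s) (f y) y :=
  intervalIntegral.integral_hasDerivAt_right (hf.intervalIntegrable hy.le)
    (hf.cont.stronglyMeasurableAtFilter isOpen_Ioi y hy)
    (hf.cont.continuousAt (Ioi_mem_nhds hy))

end Admissible

/-- The kernel `(1 - e^{2/y - 2/s}) / 2`, with values in `[0, 1/2]` for `0 < s ≤ y`. -/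
def volterraKernel (y s : ℝ) : ℝ := (1 - Real.exp (2 / y - 2 / s)) / 2

/-- The Volterra operator with kernel `volterraKernel`. -/
def volterra (f : ℝ → ℂ) (y : ℝ) : ℂ := ∫ s in (0 : ℝ)..y, (volterraKernel y s : ℂ) * f s

theorem volterraKernel_nonneg {y s : ℝ} (hs : s ∈ Ioc 0 y) : 0 ≤ volterraKernel y s := by
  have h : 2 / y - 2 / s ≤ 0 :=
    sub_nonpos.2 (div_le_div_of_nonneg_left (by norm_num) hs.1 hs.2)
  have := Real.exp_le_one_iff.2 h
  unfold volterraKernel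
  linarith

theorem volterraKernel_le {y s : ℝ} : volterraKernel y s ≤ 1 / 2 := by
  have := Real.exp_pos (2 / y - 2 / s)
  unfold volterraKernel
  linarith

theorem admissible_volterraKernel (y : ℝ) : Admissible fun s => (volterraKernel y s : ℂ) := by
  refine ((Admissible.const (1 / 2)).sub ((Admissible.const (Real.exp (2 / y) / 2 : ℝ)).mul
    Admissible.exp_neg_two_div)).congr fun s _ => ?_
  rw [volterraKernel, sub_eq_add_neg (2 / y), Real.exp_add, ← neg_div]
  push_cast
  ring

/-- Splitting the kernel moves its dependence on `y` outside the integrals, so that $Vf$ can be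
differentiated by the fundamental theorem of calculus. -/
theorem volterra_eq {f : ℝ → ℂ} (hf : Admissible f) {y : ℝ} (hy : 0 ≤ y) :
    volterra f y = (∫ s in (0 : ℝ)..y, f s) / 2 - (Real.exp (2 / y) / 2 : ℝ) *
      ∫ s in (0 : ℝ)..y, (Real.exp (-2 / s) : ℝ) * f s := by
  have h1 := (((Admissible.const (1 / 2)).mul hf).intervalIntegrable hy)
  have h2 := (((Admissible.const (Real.exp (2 / y) / 2 : ℝ)).mul
    (Admissible.exp_neg_two_div.mul hf)).intervalIntegrable hy)
  rw [div_eq_inv_mul, ← intervalIntegral.integral_const_mul, ← intervalIntegral.integral_const_mul,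
    ← intervalIntegral.integral_sub (by simpa using h1) h2]
  refine intervalIntegral.integral_congr fun s _ => ?_
  simp only [volterraKernel]
  rw [sub_eq_add_neg (2 / y), Real.exp_add, ← neg_div]
  push_cast
  ring

theorem volterra_congr {f g : ℝ → ℂ} {y : ℝ} (hy : 0 ≤ y) (h : ∀ s ∈ Ioc 0 y, f s = g s) :
    volterra f y = volterra g y := by
  refine intervalIntegral.integral_congr_ae (Eventually.of_forall fun s hs => ?_)
  rw [uIoc_of_le hy] at hs
  simp only [h s hs]

theorem volterra_add {f g : ℝ → ℂ} (hf : Admissible f) (hg : Admissible g) {y : ℝ} (hy : 0 ≤ y) :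
    volterra (fun s => f s + g s) y = volterra f y + volterra g y := by
  rw [volterra, volterra, volterra, ← intervalIntegral.integral_add]
  · simp only [mul_add]
  · exact ((admissible_volterraKernel y).mul hf).intervalIntegrable hy
  · exact ((admissible_volterraKernel y).mul hg).intervalIntegrable hy

theorem volterra_const_mul (c : ℂ) (f : ℝ → ℂ) (y : ℝ) :
    volterra (fun s => c * f s) y = c * volterra f y := by
  rw [volterra, volterra, ← intervalIntegral.integral_const_mul]
  exact intervalIntegral.integral_congr fun s _ => by ring

theorem volterra_sub {f g : ℝ → ℂ} (hf : Admissible f) (hg : Admissible g) {y : ℝ} (hy : 0 ≤ y) :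
    volterra (fun s => f s - g s) y = volterra f y - volterra g y := by
  rw [volterra, volterra, volterra, ← intervalIntegral.integral_sub]
  · simp only [mul_sub]
  · exact ((admissible_volterraKernel y).mul hf).intervalIntegrable hy
  · exact ((admissible_volterraKernel y).mul hg).intervalIntegrable hy

/-- The derivative of `volterra f`. -/
def volterraDeriv (f : ℝ → ℂ) (y : ℝ) : ℂ :=
  (Real.exp (2 / y) / y ^ 2 : ℝ) * ∫ s in (0 : ℝ)..y, (Real.exp (-2 / s) : ℝ) * f s

theorem hasDerivAt_exp_two_div {y : ℝ} (hy : 0 < y) :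
    HasDerivAt (fun y : ℝ => Real.exp (2 / y)) (-2 / y ^ 2 * Real.exp (2 / y)) y := by
  have := ((hasDerivAt_const y (2 : ℝ)).div (hasDerivAt_id y) hy.ne').exp
  refine this.congr_deriv ?_
  change Real.exp (2 / y) * ((0 * y - 2 * 1) / y ^ 2) = _
  ring

theorem hasDerivAt_volterra {f : ℝ → ℂ} (hf : Admissible f) {y : ℝ} (hy : 0 < y) :
    HasDerivAt (volterra f) (volterraDeriv f y) y := by
  have h1 := (hf.hasDerivAt_integral hy).div_const 2
  have h2 := ((Admissible.exp_neg_two_div.mul hf).hasDerivAt_integral hy)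
  have h3 := ((hasDerivAt_exp_two_div hy).div_const 2).ofReal_comp
  have h4 := h1.sub (h3.mul h2)
  refine (h4.congr_of_eventuallyEq ?_).congr_deriv ?_
  · filter_upwards [Ioi_mem_nhds hy] with u hu
    exact volterra_eq hf (le_of_lt hu)
  -- The two terms in `f y` cancel because the kernel vanishes on the diagonal.
  · have : ((Real.exp (2 / y) : ℝ) : ℂ) * ((Real.exp (-2 / y) : ℝ) : ℂ) = 1 := by
      rw [← Complex.ofReal_mul, ← Real.exp_add, neg_div]
      simp
    unfold volterraDeriv
    push_cast at this ⊢
    linear_combination (-(f y / 2)) * this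

/-- In other words, $u=Vf$ solves $y^2u''+(2y+2)u'=f$. -/
theorem hasDerivAt_volterraDeriv {f : ℝ → ℂ} (hf : Admissible f) {y : ℝ} (hy : 0 < y) :
    HasDerivAt (volterraDeriv f)
      ((f y - (2 * y + 2 : ℝ) * volterraDeriv f y) / (y : ℂ) ^ 2) y := by
  have h2 := ((Admissible.exp_neg_two_div.mul hf).hasDerivAt_integral hy)
  have h3 := ((hasDerivAt_exp_two_div hy).div (hasDerivAt_pow 2 y) (by positivity)).ofReal_comp
  refine (h3.mul h2).congr_deriv ?_
  have : ((Real.exp (2 / y) : ℝ) : ℂ) * ((Real.exp (-2 / y) : ℝ) : ℂ) = 1 := by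
    rw [← Complex.ofReal_mul, ← Real.exp_add, neg_div]
    simp
  unfold volterraDeriv
  have hy' : (y : ℂ) ≠ 0 := by exact_mod_cast hy.ne'
  simp only [Pi.div_apply]
  rw [neg_div] at this ⊢
  push_cast at this ⊢
  field_simp
  linear_combination (f y * y ^ 2) * this

/-- Each application of $V$ gains a factor $y/(2(n+1))$. This produces the factorials in the Neumann
series and the extra powers of $y$ in the comparison of potentials. -/
theorem norm_volterra_le {f : ℝ → ℂ} {y C : ℝ} (n : ℕ) (hy : 0 ≤ y)
    (h : ∀ s ∈ Ioc 0 y, ‖f s‖ ≤ C * s ^ n) :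
    ‖volterra f y‖ ≤ C / 2 * (y ^ (n + 1) / (n + 1)) := by
  have : ∫ s in (0 : ℝ)..y, C / 2 * s ^ n = C / 2 * (y ^ (n + 1) / (n + 1)) := by
    rw [intervalIntegral.integral_const_mul, integral_pow]
    simp
  rw [← this]
  refine intervalIntegral.norm_integral_le_of_norm_le hy (Eventually.of_forall fun s hs => ?_)
    (Continuous.intervalIntegrable (by fun_prop) _ _)
  rw [norm_mul, Complex.norm_real, Real.norm_of_nonneg (volterraKernel_nonneg hs)]
  calc volterraKernel y s * ‖f s‖ ≤ 1 / 2 * (C * s ^ n) :=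
        mul_le_mul volterraKernel_le (h s hs) (norm_nonneg _) (by norm_num)
    _ = _ := by ring

theorem Admissible.volterra {f : ℝ → ℂ} (hf : Admissible f) : Admissible (volterra f) := by
  refine ⟨fun y hy => (hasDerivAt_volterra hf hy).continuousAt.continuousWithinAt, fun Y => ?_⟩
  obtain ⟨C, hC, h⟩ := hf.bdd Y
  refine ⟨C / 2 * |Y|, by positivity, fun y hy => ?_⟩
  refine (norm_volterra_le (C := C) 0 hy.1.le fun s hs => ?_).trans ?_
  · simpa using h s ⟨hs.1, hs.2.trans hy.2⟩
  · simp only [zero_add, pow_one, Nat.cast_zero, div_one]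
    exact mul_le_mul_of_nonneg_left (hy.2.trans (le_abs_self _)) (by positivity)

/-! ### The Neumann series -/

/-- Terms of the Neumann series of `w = 1 + volterra (q w)`. -/
def neumannTerm (q : ℝ → ℂ) : ℕ → ℝ → ℂ
  | 0 => fun _ => 1
  | n + 1 => volterra fun s => q s * neumannTerm q n s

/-- The sum of the Neumann series. -/
def neumannSum (q : ℝ → ℂ) (y : ℝ) : ℂ := ∑' n, neumannTerm q n y

theorem Admissible.neumannTerm {q : ℝ → ℂ} (hq : Admissible q) :
    ∀ n, Admissible (neumannTerm q n)
  | 0 => Admissible.const 1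
  | n + 1 => (hq.mul (Admissible.neumannTerm hq n)).volterra

/-- Stated for any sequence obeying the recursion, to serve twice: for the Neumann terms, and for a
constant sequence, where it forces a solution of the homogeneous equation to vanish. -/
theorem norm_iterate_le {q : ℝ → ℂ} {f : ℕ → ℝ → ℂ} {Y B M : ℝ} (hB : 0 ≤ B)
    (h0 : ∀ s ∈ Ioc 0 Y, ‖f 0 s‖ ≤ M)
    (hf : ∀ n, ∀ s ∈ Ioc 0 Y, f (n + 1) s = volterra (fun s => q s * f n s) s)
    (hq : ∀ s ∈ Ioc 0 Y, ‖q s‖ ≤ B) (n : ℕ) :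
    ∀ s ∈ Ioc 0 Y, ‖f n s‖ ≤ M * ((B / 2 * s) ^ n / n.factorial) := by
  induction n with
  | zero => simpa using h0
  | succ n ih =>
    intro y hy
    rw [hf n y hy]
    refine (norm_volterra_le (C := B * (M * ((B / 2) ^ n / n.factorial))) n hy.1.le
      fun s hs => ?_).trans (le_of_eq ?_)
    · have hs' : s ∈ Ioc 0 Y := ⟨hs.1, hs.2.trans hy.2⟩
      rw [norm_mul]
      refine (mul_le_mul (hq s hs') (ih s hs') (norm_nonneg _) hB).trans (le_of_eq ?_)
      ring
    · rw [Nat.factorial_succ]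
      push_cast
      field_simp
      ring

theorem norm_neumannTerm_le {q : ℝ → ℂ} {Y B : ℝ} (hB : 0 ≤ B) (hq : ∀ s ∈ Ioc 0 Y, ‖q s‖ ≤ B)
    (n : ℕ) {s : ℝ} (hs : s ∈ Ioc 0 Y) :
    ‖neumannTerm q n s‖ ≤ (B / 2 * Y) ^ n / n.factorial := by
  have := norm_iterate_le (M := 1) hB (f := neumannTerm q) (by simp [neumannTerm])
    (fun n s _ => rfl) hq n s hs
  rw [one_mul] at this
  refine this.trans ?_
  have := hs.1
  have := hs.2
  gcongr

theorem summable_neumannTerm {q : ℝ → ℂ} (hq : Admissible q) {y : ℝ} (hy : 0 < y) :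
    Summable fun n => ‖neumannTerm q n y‖ := by
  obtain ⟨B, hB, h⟩ := hq.bdd y
  exact Summable.of_nonneg_of_le (fun _ => norm_nonneg _)
    (fun n => norm_neumannTerm_le hB h n ⟨hy, le_rfl⟩) (Real.summable_pow_div_factorial _)

theorem Admissible.neumannSum {q : ℝ → ℂ} (hq : Admissible q) : Admissible (neumannSum q) := by
  constructor
  · intro y hy
    obtain ⟨B, hB, h⟩ := hq.bdd (y + 1)
    have h1 : ContinuousOn (_root_.neumannSum q) (Ioc 0 (y + 1)) :=
      continuousOn_tsum (fun n => (hq.neumannTerm n).cont.mono Ioc_subset_Ioi_self)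
        (Real.summable_pow_div_factorial _) fun n s hs => norm_neumannTerm_le hB h n hs
    exact (h1.continuousAt (Ioc_mem_nhds hy (lt_add_one y))).continuousWithinAt
  · intro Y
    obtain ⟨B, hB, h⟩ := hq.bdd Y
    by_cases hY : 0 < Y
    · refine ⟨∑' n : ℕ, (B / 2 * Y) ^ n / n.factorial, tsum_nonneg fun n => by positivity,
        fun s hs => ?_⟩
      exact tsum_of_norm_bounded (Real.summable_pow_div_factorial _).hasSum
        fun n => norm_neumannTerm_le hB h n hs
    · exact ⟨0, le_rfl, fun s hs => absurd (hs.1.trans_le hs.2) hY⟩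

theorem neumannSum_eq {q : ℝ → ℂ} (hq : Admissible q) {y : ℝ} (hy : 0 < y) :
    neumannSum q y = 1 + volterra (fun s => q s * neumannSum q s) y := by
  obtain ⟨B, hB, h⟩ := hq.bdd y
  have hs : Summable fun n => neumannTerm q n y := (summable_neumannTerm hq hy).of_norm
  have key : HasSum (fun n => neumannTerm q (n + 1) y)
      (volterra (fun s => q s * neumannSum q s) y) := by
    have hsum : Summable fun n : ℕ => 1 / 2 * (B * ((B / 2 * y) ^ n / n.factorial)) :=
      ((Real.summable_pow_div_factorial _).mul_left _).mul_left _
    refine intervalIntegral.hasSum_integral_of_dominated_convergence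
      (fun n _ => 1 / 2 * (B * ((B / 2 * y) ^ n / n.factorial))) (fun n => ?_) (fun n => ?_)
      (Eventually.of_forall fun _ _ => hsum) intervalIntegrable_const ?_
    · rw [uIoc_of_le hy.le]
      exact (((admissible_volterraKernel y).mul (hq.mul (hq.neumannTerm n))).integrableOn
        y).aestronglyMeasurable
    · refine Eventually.of_forall fun s hs => ?_
      rw [uIoc_of_le hy.le] at hs
      rw [norm_mul, norm_mul, Complex.norm_real, Real.norm_of_nonneg (volterraKernel_nonneg hs)]
      have := volterraKernel_nonneg hs
      have := volterraKernel_le (y := y) (s := s)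
      have := h s hs
      have := norm_neumannTerm_le hB h n hs
      gcongr
    · refine Eventually.of_forall fun s hs => ?_
      rw [uIoc_of_le hy.le] at hs
      exact ((summable_neumannTerm hq hs.1).of_norm.hasSum.mul_left _).mul_left _
  rw [neumannSum, hs.tsum_eq_zero_add, key.tsum_eq]
  rfl

/-- Bounded solutions of the Volterra equation are multiples of the Neumann sum. -/
theorem eq_const_mul_neumannSum {q v : ℝ → ℂ} (hq : Admissible q) (hv : Admissible v) (c : ℂ)
    (h : ∀ y, 0 < y → v y = c + volterra (fun s => q s * v s) y) {y : ℝ} (hy : 0 < y) :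
    v y = c * neumannSum q y := by
  have hd : Admissible fun s => v s - c * neumannSum q s :=
    hv.sub ((Admissible.const c).mul hq.neumannSum)
  obtain ⟨B, hB, hqB⟩ := hq.bdd y
  obtain ⟨M, _, hM⟩ := hd.bdd y
  have hfix : ∀ s ∈ Ioc 0 y, v s - c * neumannSum q s =
      volterra (fun s => q s * (v s - c * neumannSum q s)) s := by
    intro s hs
    have h1 := volterra_sub (hq.mul hv) ((Admissible.const c).mul (hq.mul hq.neumannSum)) hs.1.le
    rw [volterra_const_mul] at h1
    rw [show (fun s => q s * (v s - c * neumannSum q s)) =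
      fun s => q s * v s - c * (q s * neumannSum q s) by funext s; ring, h1]
    nth_rw 1 [h s hs.1, neumannSum_eq hq hs.1]
    ring
  have hle := fun n : ℕ => norm_iterate_le (f := fun _ s => v s - c * neumannSum q s) hB hM
    (fun _ => hfix) hqB n y ⟨hy, le_rfl⟩
  have h0 : Tendsto (fun n : ℕ => M * ((B / 2 * y) ^ n / n.factorial)) atTop (𝓝 0) := by
    simpa using (FloorSemiring.tendsto_pow_div_factorial_atTop (B / 2 * y)).const_mul M
  have := ge_of_tendsto' h0 hle
  exact sub_eq_zero.1 (norm_le_zero_iff.1 this)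

theorem hasDerivAt_neumannSum {q : ℝ → ℂ} (hq : Admissible q) {y : ℝ} (hy : 0 < y) :
    HasDerivAt (neumannSum q) (volterraDeriv (fun s => q s * neumannSum q s) y) y := by
  refine ((hasDerivAt_volterra (hq.mul hq.neumannSum) hy).const_add 1).congr_of_eventuallyEq ?_
  filter_upwards [Ioi_mem_nhds hy] with u hu
  exact neumannSum_eq hq hu

/-- Monotonicity of the Neumann sum in the potential. -/
theorem norm_neumannSum_le {q₁ : ℝ → ℂ} {q₂ : ℝ → ℝ}
    (h2 : Admissible fun s => (q₂ s : ℂ)) {y : ℝ} (hy : 0 < y)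
    (h : ∀ s ∈ Ioc 0 y, ‖q₁ s‖ ≤ q₂ s) :
    ‖neumannSum q₁ y‖ ≤ ‖neumannSum (fun s => (q₂ s : ℂ)) y‖ := by
  -- The induction also carries the fact that the majorant terms are real, so that each can be
  -- rewritten as a real integral dominating the norm.
  have key : ∀ n, ∀ x ∈ Ioc 0 y, ‖neumannTerm q₁ n x‖ ≤ (neumannTerm (fun s => (q₂ s : ℂ)) n x).re ∧
      neumannTerm (fun s => (q₂ s : ℂ)) n x =
        ((neumannTerm (fun s => (q₂ s : ℂ)) n x).re : ℂ) := by
    intro n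
    induction n with
    | zero => intro x _; simp [neumannTerm]
    | succ n ih =>
      intro x hx
      set r := fun s => (neumannTerm (fun s => (q₂ s : ℂ)) n s).re with hr
      have hsub : ∀ s ∈ Ioc 0 x, s ∈ Ioc 0 y := fun s hs => ⟨hs.1, hs.2.trans hx.2⟩
      have hadm := ((admissible_volterraKernel x).mul (h2.mul (h2.neumannTerm n)))
      have e : neumannTerm (fun s => (q₂ s : ℂ)) (n + 1) x =
          ((∫ s in (0 : ℝ)..x, volterraKernel x s * (q₂ s * r s) : ℝ) : ℂ) := by
        rw [← intervalIntegral.integral_ofReal]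
        refine (volterra_congr (g := fun s => (q₂ s * r s : ℂ)) hx.1.le fun s hs => ?_).trans ?_
        · simp only [hr]
          rw [← (ih s (hsub s hs)).2]
        · simp only [volterra]
          push_cast
          rfl
      have hint : IntervalIntegrable (fun s => volterraKernel x s * (q₂ s * r s)) volume 0 x := by
        have := (hadm.intervalIntegrable hx.1.le)
        rw [intervalIntegrable_iff_integrableOn_Ioc_of_le hx.1.le] at this ⊢
        refine (this.re).congr ?_
        refine (ae_restrict_iff' measurableSet_Ioc).2 (Eventually.of_forall fun s _ => ?_)
        simp [hr]
      rw [e, Complex.ofReal_re]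
      refine ⟨?_, rfl⟩
      refine intervalIntegral.norm_integral_le_of_norm_le hx.1.le
        (Eventually.of_forall fun s hs => ?_) hint
      rw [norm_mul, norm_mul, Complex.norm_real, Real.norm_of_nonneg (volterraKernel_nonneg hs)]
      have := volterraKernel_nonneg hs
      have := h s (hsub s hs)
      have := (ih s (hsub s hs)).1
      gcongr
      exact (norm_nonneg _).trans (h s (hsub s hs))
  have hs2 := (summable_neumannTerm h2 hy).of_norm.hasSum
  have hre := Complex.hasSum_re hs2
  have := tsum_of_norm_bounded hre fun n => (key n y ⟨hy, le_rfl⟩).1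
  exact this.trans (Complex.re_le_norm _)

/-! ### Dependence on a spectral parameter -/

/-- Polynomial families `lam ↦ F lam` of admissible functions. -/
inductive AdmissibleFamily : (ℂ → ℝ → ℂ) → Prop
  | const (f : ℝ → ℂ) (hf : Admissible f) : AdmissibleFamily fun _ => f
  | add (F G : ℂ → ℝ → ℂ) (hF : AdmissibleFamily F) (hG : AdmissibleFamily G) :
      AdmissibleFamily fun lam s => F lam s + G lam s
  | smul (F : ℂ → ℝ → ℂ) (hF : AdmissibleFamily F) : AdmissibleFamily fun lam s => lam * F lam s

namespace AdmissibleFamily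

theorem admissible {F : ℂ → ℝ → ℂ} (hF : AdmissibleFamily F) (lam : ℂ) : Admissible (F lam) := by
  induction hF with
  | const f hf => exact hf
  | add F G _ _ ihF ihG => exact ihF.add ihG
  | smul F _ ih => exact (Admissible.const lam).mul ih

theorem differentiable {F : ℂ → ℝ → ℂ} (hF : AdmissibleFamily F) (y : ℝ) :
    Differentiable ℂ fun lam => F lam y := by
  induction hF with
  | const f hf => exact differentiable_const _
  | add F G _ _ ihF ihG => exact ihF.add ihG
  | smul F _ ih => exact differentiable_id.mul ih

theorem mul_left {F : ℂ → ℝ → ℂ} (hF : AdmissibleFamily F) {q : ℝ → ℂ} (hq : Admissible q) :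
    AdmissibleFamily fun lam s => q s * F lam s := by
  induction hF with
  | const f hf => exact .const _ (hq.mul hf)
  | add F G _ _ ihF ihG => simpa only [mul_add] using ihF.add _ _ ihG
  | smul F _ ih => simpa only [mul_left_comm] using ih.smul

theorem exists_volterra {F : ℂ → ℝ → ℂ} (hF : AdmissibleFamily F) :
    ∃ G, AdmissibleFamily G ∧ ∀ lam y, 0 < y → volterra (F lam) y = G lam y := by
  induction hF with
  | const f hf => exact ⟨_, .const _ hf.volterra, fun _ _ _ => rfl⟩
  | add F G hF hG ihF ihG =>
    obtain ⟨F', hF', h1⟩ := ihF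
    obtain ⟨G', hG', h2⟩ := ihG
    refine ⟨_, hF'.add _ _ hG', fun lam y hy => ?_⟩
    rw [volterra_add (hF.admissible lam) (hG.admissible lam) hy.le, h1 lam y hy, h2 lam y hy]
  | smul F hF ih =>
    obtain ⟨F', hF', h1⟩ := ih
    refine ⟨_, hF'.smul, fun lam y hy => ?_⟩
    rw [volterra_const_mul, h1 lam y hy]

end AdmissibleFamily

/-- Each Neumann term is polynomial in `lam`, so its holomorphy needs no differentiation under the
integral sign. -/
theorem exists_admissibleFamily_neumannTerm {q : ℝ → ℂ} (hq : Admissible q) (n : ℕ) :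
    ∃ G, AdmissibleFamily G ∧
      ∀ lam y, 0 < y → neumannTerm (fun s => q s - lam) n y = G lam y := by
  induction n with
  | zero => exact ⟨_, .const _ (Admissible.const 1), fun _ _ _ => rfl⟩
  | succ n ih =>
    obtain ⟨F, hF, h⟩ := ih
    obtain ⟨G, hG, h'⟩ := AdmissibleFamily.exists_volterra
      ((hF.mul_left hq).add _ _ ((hF.mul_left (Admissible.const (-1))).smul))
    refine ⟨G, hG, fun lam y hy => ?_⟩
    rw [← h' lam y hy]
    refine volterra_congr hy.le fun s hs => ?_
    rw [h lam s hs.1]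
    ring

theorem differentiable_neumannSum {q : ℝ → ℂ} (hq : Admissible q) {y : ℝ} (hy : 0 < y) :
    Differentiable ℂ fun lam => neumannSum (fun s => q s - lam) y := by
  intro lam₀
  obtain ⟨B, hB, h⟩ := hq.bdd y
  have : DifferentiableOn ℂ (fun lam => neumannSum (fun s => q s - lam) y)
      (Metric.ball 0 (‖lam₀‖ + 1)) := by
    refine Complex.differentiableOn_tsum_of_summable_norm
      (Real.summable_pow_div_factorial ((B + (‖lam₀‖ + 1)) / 2 * y)) (fun n => ?_)
      Metric.isOpen_ball fun n lam hlam => ?_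
    · obtain ⟨G, hG, hG'⟩ := exists_admissibleFamily_neumannTerm hq n
      rw [funext fun lam => hG' lam y hy]
      exact (hG.differentiable y).differentiableOn
    · refine norm_neumannTerm_le (by positivity) (fun s hs => ?_) n ⟨hy, le_rfl⟩
      rw [mem_ball_zero_iff] at hlam
      exact norm_sub_le_of_le (h s hs) hlam.le
  exact this.differentiableAt (Metric.isOpen_ball.mem_nhds (by simp))

/-! ### Modified Bessel functions -/

theorem norm_cosh_mul_ofReal_le (ν : ℂ) {t : ℝ} (ht : 0 ≤ t) :
    ‖Complex.cosh (ν * t)‖ ≤ Real.exp (‖ν‖ * t) := by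
  have h : ∀ z : ℂ, ‖z‖ = ‖ν‖ * t → ‖Complex.exp z‖ ≤ Real.exp (‖ν‖ * t) := fun z hz =>
    hz ▸ Complex.norm_exp_le_exp_norm z
  have e : ‖ν * t‖ = ‖ν‖ * t := by rw [norm_mul, Complex.norm_real, Real.norm_of_nonneg ht]
  rw [Complex.cosh, norm_div, Complex.norm_ofNat, div_le_iff₀ two_pos]
  have := norm_add_le_of_le (h _ e) (h (-(ν * t)) (by rw [norm_neg, e]))
  linarith

theorem norm_sinh_mul_ofReal_le (ν : ℂ) {t : ℝ} (ht : 0 ≤ t) :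
    ‖Complex.sinh (ν * t)‖ ≤ Real.exp (‖ν‖ * t) := by
  have h : ∀ z : ℂ, ‖z‖ = ‖ν‖ * t → ‖Complex.exp z‖ ≤ Real.exp (‖ν‖ * t) := fun z hz =>
    hz ▸ Complex.norm_exp_le_exp_norm z
  have e : ‖ν * t‖ = ‖ν‖ * t := by rw [norm_mul, Complex.norm_real, Real.norm_of_nonneg ht]
  rw [Complex.sinh, norm_div, Complex.norm_ofNat, div_le_iff₀ two_pos]
  have := norm_sub_le_of_le (h _ e) (h (-(ν * t)) (by rw [norm_neg, e]))
  linarith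

/-- Keep a single term of the series of $\exp(ze^t/2)\le\exp(z\cosh t)$. The explicit constant later
gives the factorial growth of $K_n$ in $n$. -/
theorem exp_nat_mul_le {z : ℝ} (hz : 0 < z) (N : ℕ) (t : ℝ) :
    Real.exp (N * t) ≤ N.factorial * (2 / z) ^ N * Real.exp (z * Real.cosh t) := by
  have h1 := Real.pow_div_factorial_le_exp (z * Real.exp t / 2) (by positivity) N
  have h2 : z * Real.exp t / 2 ≤ z * Real.cosh t := by
    rw [Real.cosh_eq]
    have := Real.exp_pos (-t)
    nlinarith
  have h3 := h1.trans (Real.exp_le_exp.2 h2)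
  rw [div_le_iff₀ (by positivity)] at h3
  calc Real.exp (N * t) = (z * Real.exp t / 2) ^ N * (2 / z) ^ N := by
        rw [← mul_pow, Real.exp_nat_mul]
        congr 1
        field_simp
    _ ≤ (Real.exp (z * Real.cosh t) * N.factorial) * (2 / z) ^ N := by gcongr
    _ = _ := by ring

theorem cosh_le_exp_of_nonneg {t : ℝ} (ht : 0 ≤ t) : Real.cosh t ≤ Real.exp t := by
  rw [Real.cosh_eq]
  have : Real.exp (-t) ≤ Real.exp t := Real.exp_le_exp.2 (by linarith)
  linarith

theorem exists_besselIntegrand_le {z : ℝ} (hz : 0 < z) (μ : ℝ) (j : ℕ) :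
    ∃ C : ℝ, ∀ t : ℝ, 0 ≤ t →
      Real.cosh t ^ j * Real.exp (-(z * Real.cosh t)) * Real.exp (μ * t) ≤ C * Real.exp (-t) := by
  obtain ⟨N, hN⟩ := exists_nat_ge (j + μ + 1)
  refine ⟨N.factorial * (2 / z) ^ N, fun t ht => ?_⟩
  have h1 : Real.cosh t ^ j ≤ Real.exp (j * t) := by
    rw [Real.exp_nat_mul]
    exact pow_le_pow_left₀ (Real.cosh_pos t).le (cosh_le_exp_of_nonneg ht) j
  calc Real.cosh t ^ j * Real.exp (-(z * Real.cosh t)) * Real.exp (μ * t)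
      ≤ Real.exp (j * t) * Real.exp (-(z * Real.cosh t)) * Real.exp (μ * t) := by gcongr
    _ = Real.exp ((j + μ + 1) * t) * (Real.exp (-(z * Real.cosh t)) * Real.exp (-t)) := by
        simp only [← Real.exp_add]
        ring_nf
    _ ≤ Real.exp (N * t) * (Real.exp (-(z * Real.cosh t)) * Real.exp (-t)) := by gcongr
    _ ≤ (N.factorial * (2 / z) ^ N * Real.exp (z * Real.cosh t)) *
        (Real.exp (-(z * Real.cosh t)) * Real.exp (-t)) := by
        have := exp_nat_mul_le hz N t
        gcongr
    _ = N.factorial * (2 / z) ^ N * Real.exp (-t) *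
        (Real.exp (z * Real.cosh t) * Real.exp (-(z * Real.cosh t))) := by ring
    _ = _ := by rw [← Real.exp_add, add_neg_cancel, Real.exp_zero, mul_one]

/-- The integrand of `besselMoment`. -/
def besselIntegrand (j : ℕ) (ν : ℂ) (z t : ℝ) : ℂ :=
  ((Real.cosh t ^ j * Real.exp (-(z * Real.cosh t)) : ℝ) : ℂ) * Complex.cosh (ν * t)

/-- The integrals `∫_0^∞ cosh(t)^j exp(-z cosh t) cosh(ν t) dt`. -/
def besselMoment (j : ℕ) (ν : ℂ) (z : ℝ) : ℂ := ∫ t in Ioi (0 : ℝ), besselIntegrand j ν z t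

theorem besselMoment_zero (ν : ℂ) (z : ℝ) : besselMoment 0 ν z = besselK ν z := by
  simp [besselMoment, besselIntegrand, besselK]

theorem continuous_besselIntegrand (j : ℕ) (ν : ℂ) (z : ℝ) :
    Continuous (besselIntegrand j ν z) := by
  unfold besselIntegrand
  fun_prop

theorem norm_besselIntegrand_le (j : ℕ) (ν : ℂ) (z : ℝ) {t : ℝ} (ht : 0 ≤ t) :
    ‖besselIntegrand j ν z t‖ ≤
      Real.cosh t ^ j * Real.exp (-(z * Real.cosh t)) * Real.exp (‖ν‖ * t) := by
  have := Real.cosh_pos t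
  rw [besselIntegrand, norm_mul, Complex.norm_real, Real.norm_of_nonneg (by positivity)]
  gcongr
  exact norm_cosh_mul_ofReal_le ν ht

theorem integrableOn_exp_neg : IntegrableOn (fun t : ℝ => Real.exp (-t)) (Ioi 0) := by
  simpa using exp_neg_integrableOn_Ioi 0 one_pos

theorem integrableOn_of_norm_le_exp_neg {E : Type*} [NormedAddCommGroup E] {f : ℝ → E}
    (hf : Continuous f) {C : ℝ} (h : ∀ t, 0 ≤ t → ‖f t‖ ≤ C * Real.exp (-t)) :
    IntegrableOn f (Ioi 0) := by
  refine Integrable.mono' (integrableOn_exp_neg.const_mul C) hf.aestronglyMeasurable ?_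
  exact (ae_restrict_iff' measurableSet_Ioi).2 (Eventually.of_forall fun t ht => h t (le_of_lt ht))

theorem integrableOn_besselIntegrand (j : ℕ) (ν : ℂ) {z : ℝ} (hz : 0 < z) :
    IntegrableOn (besselIntegrand j ν z) (Ioi 0) := by
  obtain ⟨C, hC⟩ := exists_besselIntegrand_le hz ‖ν‖ j
  exact integrableOn_of_norm_le_exp_neg (continuous_besselIntegrand j ν z) fun t ht =>
    (norm_besselIntegrand_le j ν z ht).trans (hC t ht)

theorem hasDerivAt_besselMoment (j : ℕ) (ν : ℂ) {z : ℝ} (hz : 0 < z) :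
    HasDerivAt (besselMoment j ν) (-besselMoment (j + 1) ν z) z := by
  -- The bound at `z / 2` dominates the differentiated integrand uniformly over the neighbourhood
  -- $(z/2,\infty)$ of `z`.
  obtain ⟨C, hC⟩ := exists_besselIntegrand_le (half_pos hz) ‖ν‖ (j + 1)
  have := (hasDerivAt_integral_of_dominated_loc_of_deriv_le (𝕜 := ℝ)
    (μ := volume.restrict (Ioi 0)) (bound := fun t => C * Real.exp (-t))
    (F := besselIntegrand j ν) (F' := fun z t => -besselIntegrand (j + 1) ν z t)
    (Ioi_mem_nhds (half_lt_self hz))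
    (Eventually.of_forall fun z => (continuous_besselIntegrand j ν z).aestronglyMeasurable)
    (integrableOn_besselIntegrand j ν hz)
    (continuous_besselIntegrand (j + 1) ν z).neg.aestronglyMeasurable ?_
    (integrableOn_exp_neg.const_mul C) ?_).2
  · rwa [integral_neg] at this
  · refine (ae_restrict_iff' measurableSet_Ioi).2 (Eventually.of_forall fun t ht x hx => ?_)
    have ht' : 0 ≤ t := le_of_lt ht
    rw [norm_neg]
    refine (norm_besselIntegrand_le (j + 1) ν x ht').trans (le_trans ?_ (hC t ht'))
    have := Real.cosh_pos t
    have hx' : z / 2 ≤ x := le_of_lt hx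
    gcongr
  · refine Eventually.of_forall fun t x _ => ?_
    have h1 := (((((hasDerivAt_id x).mul_const (Real.cosh t)).neg).exp.const_mul
      (Real.cosh t ^ j)).ofReal_comp).mul_const (Complex.cosh (ν * t))
    refine h1.congr_deriv ?_
    simp only [besselIntegrand, id, Pi.neg_apply]
    push_cast
    ring

theorem tendsto_zero_of_norm_le_exp_neg {f : ℝ → ℂ} {C : ℝ}
    (h : ∀ t, 0 ≤ t → ‖f t‖ ≤ C * Real.exp (-t)) : Tendsto f atTop (𝓝 0) := by
  refine squeeze_zero_norm' ?_ (by simpa using Real.tendsto_exp_neg_atTop_nhds_zero.const_mul C)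
  filter_upwards [eventually_ge_atTop 0] with t ht using h t ht

theorem abs_sinh_le_cosh (t : ℝ) : |Real.sinh t| ≤ Real.cosh t :=
  abs_le_of_sq_le_sq (by nlinarith [Real.cosh_sq t]) (Real.cosh_pos t).le

/-- The modified Bessel equation, in terms of moments. -/
theorem besselMoment_equation (ν : ℂ) {z : ℝ} (hz : 0 < z) :
    (z : ℂ) ^ 2 * besselMoment 2 ν z - z * besselMoment 1 ν z =
      ((z : ℂ) ^ 2 + ν ^ 2) * besselMoment 0 ν z := by
  have hi := fun j => integrableOn_besselIntegrand j ν hz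
  -- With $E=e^{-z\cosh t}$ and $c=\cosh\nu t$, this is $E'c-Ec'$. Its derivative $E''c-Ec''$ is the
  -- integrand of the equation, and it vanishes at $0$ and at $\infty$.
  set F : ℝ → ℂ := fun t =>
    ((-(z * Real.sinh t) * Real.exp (-(z * Real.cosh t)) : ℝ) : ℂ) * Complex.cosh (ν * t) -
      ((Real.exp (-(z * Real.cosh t)) : ℝ) : ℂ) * (Complex.sinh (ν * t) * ν) with hF
  have hderiv : ∀ t : ℝ, HasDerivAt F ((z : ℂ) ^ 2 * besselIntegrand 2 ν z t -
      z * besselIntegrand 1 ν z t - ((z : ℂ) ^ 2 + ν ^ 2) * besselIntegrand 0 ν z t) t := by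
    intro t
    have hexp := ((Real.hasDerivAt_cosh t).const_mul z).neg.exp
    have hs := ((Real.hasDerivAt_sinh t).const_mul z).neg
    have hlin : HasDerivAt (fun t : ℝ => ν * (t : ℂ)) ν t := by
      simpa using ((hasDerivAt_id t).ofReal_comp).const_mul ν
    have hc := (Complex.hasDerivAt_cosh (ν * t)).comp t hlin
    have hsn := ((Complex.hasDerivAt_sinh (ν * t)).comp t hlin).mul_const ν
    refine (((hs.mul hexp).ofReal_comp.mul hc).sub (hexp.ofReal_comp.mul hsn)).congr_deriv ?_
    have hsq : ((Real.cosh t : ℝ) : ℂ) ^ 2 = ((Real.sinh t : ℝ) : ℂ) ^ 2 + 1 := by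
      exact_mod_cast Real.cosh_sq t
    simp only [besselIntegrand, Pi.neg_apply, Pi.mul_apply, Function.comp_apply]
    push_cast at hsq ⊢
    linear_combination (-(z : ℂ) ^ 2 * Complex.exp (-(z * Complex.cosh t)) *
      Complex.cosh (ν * t)) * hsq
  obtain ⟨C₁, hC₁⟩ := exists_besselIntegrand_le hz ‖ν‖ 1
  obtain ⟨C₀, hC₀⟩ := exists_besselIntegrand_le hz ‖ν‖ 0
  have hlim : Tendsto F atTop (𝓝 0) := by
    refine tendsto_zero_of_norm_le_exp_neg (C := z * C₁ + C₀ * ‖ν‖) fun t ht => ?_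
    have h1 := hC₁ t ht
    have h0 := hC₀ t ht
    rw [pow_one] at h1
    rw [pow_zero, one_mul] at h0
    rw [add_mul]
    refine norm_sub_le_of_le ?_ ?_
    · rw [norm_mul, Complex.norm_real, Real.norm_eq_abs, abs_mul, abs_neg, abs_mul,
        abs_of_pos hz, Real.abs_exp]
      calc z * |Real.sinh t| * Real.exp (-(z * Real.cosh t)) * ‖Complex.cosh (ν * t)‖
          ≤ z * Real.cosh t * Real.exp (-(z * Real.cosh t)) * Real.exp (‖ν‖ * t) := by
            have := abs_sinh_le_cosh t
            have := norm_cosh_mul_ofReal_le ν ht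
            have := Real.cosh_pos t
            gcongr
        _ = z * (Real.cosh t * Real.exp (-(z * Real.cosh t)) * Real.exp (‖ν‖ * t)) := by ring
        _ ≤ z * (C₁ * Real.exp (-t)) := by gcongr
        _ = _ := by ring
    · rw [norm_mul, norm_mul, Complex.norm_real, Real.norm_eq_abs, Real.abs_exp]
      calc Real.exp (-(z * Real.cosh t)) * (‖Complex.sinh (ν * t)‖ * ‖ν‖)
          ≤ Real.exp (-(z * Real.cosh t)) * (Real.exp (‖ν‖ * t) * ‖ν‖) := by
            have := norm_sinh_mul_ofReal_le ν ht
            gcongr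
        _ = Real.exp (-(z * Real.cosh t)) * Real.exp (‖ν‖ * t) * ‖ν‖ := by ring
        _ ≤ C₀ * Real.exp (-t) * ‖ν‖ := by gcongr
        _ = _ := by ring
  have hint2 := (hi 2).const_mul ((z : ℂ) ^ 2)
  have hint1 := (hi 1).const_mul (z : ℂ)
  have hint0 := (hi 0).const_mul ((z : ℂ) ^ 2 + ν ^ 2)
  have h := integral_Ioi_of_hasDerivAt_of_tendsto' (fun t _ => hderiv t)
    ((hint2.sub hint1).sub hint0) hlim
  have e1 := integral_sub (hint2.sub hint1) hint0
  have e2 := integral_sub hint2 hint1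
  simp only [Pi.sub_apply] at e1 e2
  rw [e1, e2, integral_const_mul, integral_const_mul, integral_const_mul] at h
  have hF0 : F 0 = 0 := by simp [hF]
  rw [hF0, sub_zero] at h
  exact sub_eq_zero.1 h

theorem exists_norm_besselMoment_le (j : ℕ) (ν : ℂ) :
    ∃ C : ℝ, 0 ≤ C ∧ ∀ z, 1 ≤ z → ‖besselMoment j ν z‖ ≤ C := by
  obtain ⟨C, hC⟩ := exists_besselIntegrand_le one_pos ‖ν‖ j
  have hC0 : 0 ≤ C := by
    have h := hC 0 le_rfl
    simp only [mul_zero, Real.exp_zero, neg_zero, mul_one] at h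
    refine le_trans ?_ h
    have := Real.cosh_pos 0
    positivity
  refine ⟨∫ t in Ioi (0 : ℝ), C * Real.exp (-t),
    setIntegral_nonneg measurableSet_Ioi fun t _ => by positivity, fun z hz => ?_⟩
  refine norm_integral_le_of_norm_le (integrableOn_exp_neg.const_mul C) ?_
  refine (ae_restrict_iff' measurableSet_Ioi).2 (Eventually.of_forall fun t ht => ?_)
  have ht' : 0 ≤ t := le_of_lt ht
  refine (norm_besselIntegrand_le j ν z ht').trans (le_trans ?_ (hC t ht'))
  have := Real.cosh_pos t
  gcongr

/-! ### The normalized Bessel function at infinity -/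

/-- `K_ν(1/y)` divided by `y^{1/2} e^{-1/y}`. -/
def besselRatio (ν : ℂ) (y : ℝ) : ℂ :=
  (((√y)⁻¹ * Real.exp (1 / y) : ℝ) : ℂ) * besselMoment 0 ν (1 / y)

theorem sq_div_two_le_cosh_sub_one {x : ℝ} (hx : 0 ≤ x) : x ^ 2 / 2 ≤ Real.cosh x - 1 := by
  have h1 : Real.cosh x = Real.cosh (x / 2) ^ 2 + Real.sinh (x / 2) ^ 2 := by
    rw [← Real.cosh_two_mul]
    ring_nf
  have h2 := Real.cosh_sq (x / 2)
  have h3 : x / 2 ≤ Real.sinh (x / 2) := Real.self_le_sinh_iff.2 (by linarith)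
  nlinarith

/-- Laplace's scaling $t=\sqrt y\,s$: the exponent becomes at most $-s^2/2$ and converges to it as
$y\to0$. -/
theorem besselRatio_eq (ν : ℂ) {y : ℝ} (hy : 0 < y) :
    besselRatio ν y = ∫ s in Ioi (0 : ℝ),
      ((Real.exp (-((Real.cosh (√y * s) - 1) / y)) : ℝ) : ℂ) * Complex.cosh (ν * (√y * s : ℝ)) := by
  have h := integral_comp_mul_left_Ioi (fun t : ℝ =>
    ((Real.exp (-((Real.cosh t - 1) / y)) : ℝ) : ℂ) * Complex.cosh (ν * t)) 0 (Real.sqrt_pos.2 hy)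
  rw [h, mul_zero, besselRatio, besselMoment, Complex.real_smul, Complex.ofReal_mul, mul_assoc,
    ← integral_const_mul]
  congr 1
  refine integral_congr_ae (Eventually.of_forall fun t => ?_)
  simp only [besselIntegrand, pow_zero, one_mul]
  rw [← mul_assoc, ← Complex.ofReal_mul, ← Real.exp_add]
  congr 3
  ring

theorem norm_scaledIntegrand_le (ν : ℂ) {y Y s : ℝ} (hy : y ∈ Ioc 0 Y) (hs : 0 ≤ s) :
    ‖((Real.exp (-((Real.cosh (√y * s) - 1) / y)) : ℝ) : ℂ) * Complex.cosh (ν * (√y * s : ℝ))‖ ≤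
      Real.exp ((‖ν‖ * √Y + 1) ^ 2 / 2) * Real.exp (-s) := by
  have h1 : s ^ 2 / 2 ≤ (Real.cosh (√y * s) - 1) / y := by
    rw [le_div_iff₀ hy.1]
    refine le_trans (le_of_eq ?_) (sq_div_two_le_cosh_sub_one (by positivity))
    rw [mul_pow, Real.sq_sqrt hy.1.le]
    ring
  have h2 := norm_cosh_mul_ofReal_le ν (t := √y * s) (by positivity)
  have h3 : √y ≤ √Y := Real.sqrt_le_sqrt hy.2
  rw [norm_mul, Complex.norm_real, Real.norm_eq_abs, Real.abs_exp]
  calc _ ≤ Real.exp (-(s ^ 2 / 2)) * Real.exp (‖ν‖ * (√y * s)) := by gcongr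
    _ ≤ Real.exp (-(s ^ 2 / 2)) * Real.exp (‖ν‖ * (√Y * s)) := by gcongr
    _ ≤ _ := by
      rw [← Real.exp_add, ← Real.exp_add, Real.exp_le_exp]
      -- Complete the square, with one unit of the linear term reserved for the factor $e^{-s}$.
      nlinarith [sq_nonneg (s - (‖ν‖ * √Y + 1))]

/-- Since $\cosh u-1=2\sinh^2(u/2)$, the quotient is twice the square of a difference quotient of
$\sinh$ in the variable $\sqrt y$. -/
theorem tendsto_cosh_sub_one_div (s : ℝ) :
    Tendsto (fun y : ℝ => (Real.cosh (√y * s) - 1) / y) (𝓝[>] 0) (𝓝 (s ^ 2 / 2)) := by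
  have h1 : HasDerivAt (fun b : ℝ => Real.sinh (b * (s / 2))) (s / 2) 0 := by
    simpa using ((hasDerivAt_id (0 : ℝ)).mul_const (s / 2)).sinh
  have h2 := h1.tendsto_slope_zero_right
  have h3 : Tendsto (fun y : ℝ => √y) (𝓝[>] 0) (𝓝[>] 0) := by
    refine tendsto_nhdsWithin_iff.2 ⟨?_, ?_⟩
    · simpa using (Real.continuous_sqrt.tendsto 0).mono_left nhdsWithin_le_nhds
    · filter_upwards [self_mem_nhdsWithin] with y hy using Real.sqrt_pos.2 hy
  have h4 := ((h2.comp h3).pow 2).const_mul 2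
  rw [show 2 * (s / 2) ^ 2 = s ^ 2 / 2 by ring] at h4
  refine h4.congr' ?_
  filter_upwards [self_mem_nhdsWithin] with y hy
  have hy' : 0 < y := hy
  have hb : √y ≠ 0 := (Real.sqrt_pos.2 hy).ne'
  have e : Real.cosh (√y * s) = 1 + 2 * Real.sinh (√y * (s / 2)) ^ 2 := by
    rw [show √y * s = 2 * (√y * (s / 2)) by ring, Real.cosh_two_mul, Real.cosh_sq]
    ring
  simp only [Function.comp_apply, zero_add, zero_mul, Real.sinh_zero, sub_zero, smul_eq_mul]
  rw [e, mul_pow, inv_pow, Real.sq_sqrt hy'.le]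
  field_simp
  ring

theorem tendsto_besselRatio (ν : ℂ) :
    Tendsto (besselRatio ν) (𝓝[>] 0) (𝓝 ((√(Real.pi / 2) : ℝ) : ℂ)) := by
  have hlim : ((√(Real.pi / 2) : ℝ) : ℂ) =
      ∫ s in Ioi (0 : ℝ), ((Real.exp (-(s ^ 2 / 2)) : ℝ) : ℂ) * Complex.cosh (ν * 0) := by
    have h := integral_gaussian_Ioi (1 / 2)
    simp only [mul_zero, Complex.cosh_zero, mul_one]
    have hcast : ∫ s in Ioi (0 : ℝ), ((Real.exp (-(s ^ 2 / 2)) : ℝ) : ℂ) =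
        ((∫ s in Ioi (0 : ℝ), Real.exp (-(s ^ 2 / 2)) : ℝ) : ℂ) := integral_ofReal
    rw [hcast]
    have e : (fun s : ℝ => Real.exp (-(s ^ 2 / 2))) = fun s => Real.exp (-(1 / 2) * s ^ 2) := by
      funext s
      ring_nf
    rw [e, h]
    congr 1
    rw [show Real.pi / (1 / 2) = 2 ^ 2 * (Real.pi / 2) by ring,
      Real.sqrt_mul (by norm_num), Real.sqrt_sq (by norm_num)]
    ring
  rw [hlim]
  have h : Tendsto (fun y : ℝ => ∫ s in Ioi (0 : ℝ),
      ((Real.exp (-((Real.cosh (√y * s) - 1) / y)) : ℝ) : ℂ) *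
        Complex.cosh (ν * (√y * s : ℝ))) (𝓝[>] 0)
      (𝓝 (∫ s in Ioi (0 : ℝ), ((Real.exp (-(s ^ 2 / 2)) : ℝ) : ℂ) * Complex.cosh (ν * 0))) := by
    refine tendsto_integral_filter_of_dominated_convergence
      (fun s => Real.exp ((‖ν‖ * √1 + 1) ^ 2 / 2) * Real.exp (-s)) ?_ ?_
      (integrableOn_exp_neg.const_mul _) ?_
    · exact Eventually.of_forall fun y => Continuous.aestronglyMeasurable (by fun_prop)
    · filter_upwards [Ioc_mem_nhdsGT one_pos] with y hy
      exact (ae_restrict_iff' measurableSet_Ioi).2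
        (Eventually.of_forall fun s hs => norm_scaledIntegrand_le ν hy (le_of_lt hs))
    · refine Eventually.of_forall fun s => ?_
      refine Tendsto.mul ?_ ?_
      · exact (Complex.continuous_ofReal.tendsto _).comp
          ((Real.continuous_exp.tendsto _).comp (tendsto_cosh_sub_one_div s).neg)
      · have hc : Continuous fun y : ℝ => Complex.cosh (ν * (√y * s : ℝ)) := by fun_prop
        have := (hc.tendsto 0).mono_left (nhdsWithin_le_nhds (s := Ioi 0))
        simpa using this
  refine h.congr' ?_
  filter_upwards [self_mem_nhdsWithin] with y hy using (besselRatio_eq ν hy).symm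

theorem hasDerivAt_besselMoment_one_div (j : ℕ) (ν : ℂ) {y : ℝ} (hy : 0 < y) :
    HasDerivAt (fun y : ℝ => besselMoment j ν (1 / y)) (besselMoment (j + 1) ν (1 / y) / y ^ 2)
      y := by
  have h1 : HasDerivAt (fun y : ℝ => 1 / y) (-(y ^ 2)⁻¹) y := by
    simpa using hasDerivAt_inv hy.ne'
  refine ((hasDerivAt_besselMoment j ν (one_div_pos.2 hy)).scomp y h1).congr_deriv ?_
  rw [Complex.real_smul]
  push_cast
  ring

theorem hasDerivAt_inv_sqrt {y : ℝ} (hy : 0 < y) :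
    HasDerivAt (fun y : ℝ => (√y)⁻¹) (-(√y)⁻¹ / (2 * y)) y := by
  refine ((Real.hasDerivAt_sqrt hy.ne').inv (Real.sqrt_pos.2 hy).ne').congr_deriv ?_
  have h := Real.sq_sqrt hy.le
  have := (Real.sqrt_pos.2 hy).ne'
  field_simp
  rw [h]

theorem hasDerivAt_besselRatio (ν : ℂ) {y : ℝ} (hy : 0 < y) :
    HasDerivAt (besselRatio ν) ((((√y)⁻¹ * Real.exp (1 / y) : ℝ) : ℂ) *
      ((-1 / (2 * y) - 1 / y ^ 2) * besselMoment 0 ν (1 / y) +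
        besselMoment 1 ν (1 / y) / y ^ 2)) y := by
  have h1 : HasDerivAt (fun y : ℝ => 1 / y) (-(y ^ 2)⁻¹) y := by
    simpa using hasDerivAt_inv hy.ne'
  refine (((hasDerivAt_inv_sqrt hy).mul h1.exp).ofReal_comp.mul
    (hasDerivAt_besselMoment_one_div 0 ν hy)).congr_deriv ?_
  simp only [Pi.mul_apply, zero_add]
  push_cast
  ring

/-- The weighted derivative `y² e^{-2/y} v'` of `v = besselRatio ν`. -/
def besselFlux (ν : ℂ) (y : ℝ) : ℂ :=
  (((√y)⁻¹ * Real.exp (-(1 / y)) : ℝ) : ℂ) *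
    ((-(y / 2) - 1) * besselMoment 0 ν (1 / y) + besselMoment 1 ν (1 / y))

/-- Bessel's equation in divergence form, after the change of variable and normalization. -/
theorem hasDerivAt_besselFlux (ν : ℂ) {y : ℝ} (hy : 0 < y) :
    HasDerivAt (besselFlux ν)
      (((Real.exp (-2 / y) : ℝ) : ℂ) * ((ν ^ 2 - 1 / 4) * besselRatio ν y)) y := by
  have h1 : HasDerivAt (fun y : ℝ => 1 / y) (-(y ^ 2)⁻¹) y := by
    simpa using hasDerivAt_inv hy.ne'
  have h2 : HasDerivAt (fun y : ℝ => (-((y : ℂ) / 2) - 1)) (-(1 / 2)) y := by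
    simpa using ((((hasDerivAt_id y).ofReal_comp).div_const 2).neg.sub_const 1)
  refine (((hasDerivAt_inv_sqrt hy).mul h1.neg.exp).ofReal_comp.mul
    ((h2.mul (hasDerivAt_besselMoment_one_div 0 ν hy)).add
      (hasDerivAt_besselMoment_one_div 1 ν hy))).congr_deriv ?_
  have hb := besselMoment_equation ν (one_div_pos.2 hy)
  have hexp : Real.exp (-2 / y) * Real.exp (1 / y) = Real.exp (-(1 / y)) := by
    rw [← Real.exp_add]
    congr 1
    ring
  have hy' : (y : ℂ) ≠ 0 := by exact_mod_cast hy.ne'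
  rw [besselRatio]
  rw [show ((Real.exp (-2 / y) : ℝ) : ℂ) * ((ν ^ 2 - 1 / 4) *
      ((((√y)⁻¹ * Real.exp (1 / y) : ℝ) : ℂ) * besselMoment 0 ν (1 / y))) =
      (((√y)⁻¹ * (Real.exp (-2 / y) * Real.exp (1 / y)) : ℝ) : ℂ) *
      ((ν ^ 2 - 1 / 4) * besselMoment 0 ν (1 / y)) by push_cast; ring, hexp]
  simp only [Pi.mul_apply, Pi.neg_apply, Pi.add_apply, zero_add, Nat.reduceAdd]
  push_cast at hb ⊢
  linear_combination ((√y : ℂ)⁻¹ * Complex.exp (-(1 / y))) * hb +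
    ((√y : ℂ)⁻¹ * Complex.exp (-(1 / y)) * (besselMoment 0 ν (1 / y) / 4 -
      (y : ℂ)⁻¹ * (besselMoment 0 ν (1 / y) + besselMoment 1 ν (1 / y)) / 2)) *
        mul_inv_cancel₀ hy'

/-- This makes the first constant of integration zero. The moments stay bounded for $z\ge1$, and
$y^{-1/2}e^{-1/y}\le\sqrt y$. -/
theorem tendsto_besselFlux (ν : ℂ) : Tendsto (besselFlux ν) (𝓝[>] 0) (𝓝 0) := by
  obtain ⟨C₀, hC₀, h0⟩ := exists_norm_besselMoment_le 0 ν
  obtain ⟨C₁, hC₁, h1⟩ := exists_norm_besselMoment_le 1 ν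
  have hs : Tendsto (fun y : ℝ => √y * (2 * C₀ + C₁)) (𝓝[>] 0) (𝓝 0) := by
    have : Continuous fun y : ℝ => √y * (2 * C₀ + C₁) := by fun_prop
    simpa using (this.tendsto 0).mono_left (nhdsWithin_le_nhds (s := Ioi 0))
  refine squeeze_zero_norm' ?_ hs
  filter_upwards [Ioc_mem_nhdsGT one_pos] with y hy
  have hz : 1 ≤ 1 / y := (one_le_div hy.1).2 hy.2
  have hsq := Real.sqrt_pos.2 hy.1
  rw [besselFlux, norm_mul, Complex.norm_real, Real.norm_of_nonneg (by positivity)]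
  have ha : (√y)⁻¹ * Real.exp (-(1 / y)) ≤ √y := by
    rw [Real.exp_neg, ← mul_inv, inv_le_comm₀ (by positivity) hsq]
    have : 1 / y ≤ Real.exp (1 / y) := by linarith [Real.add_one_le_exp (1 / y)]
    calc (√y)⁻¹ = √y * (1 / y) := by
          have := Real.sq_sqrt hy.1.le
          have := hy.1
          field_simp
          linarith
      _ ≤ _ := by gcongr
  have hb : ‖(-((y : ℂ) / 2) - 1)‖ ≤ 2 := by
    have : (-((y : ℂ) / 2) - 1) = ((-(y / 2) - 1 : ℝ) : ℂ) := by push_cast; ring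
    rw [this, Complex.norm_real, Real.norm_eq_abs, abs_le]
    constructor <;> linarith [hy.1, hy.2]
  refine mul_le_mul ha (norm_add_le_of_le ?_ (h1 _ hz)) (norm_nonneg _) hsq.le
  rw [norm_mul]
  exact mul_le_mul hb (h0 _ hz) (norm_nonneg _) (by norm_num)

theorem admissible_besselRatio (ν : ℂ) : Admissible (besselRatio ν) := by
  refine ⟨fun y hy => (hasDerivAt_besselRatio ν hy).continuousAt.continuousWithinAt, fun Y => ?_⟩
  refine ⟨∫ s in Ioi (0 : ℝ), Real.exp ((‖ν‖ * √Y + 1) ^ 2 / 2) * Real.exp (-s),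
    setIntegral_nonneg measurableSet_Ioi fun t _ => by positivity, fun y hy => ?_⟩
  rw [besselRatio_eq ν hy.1]
  refine norm_integral_le_of_norm_le (integrableOn_exp_neg.const_mul _) ?_
  exact (ae_restrict_iff' measurableSet_Ioi).2
    (Eventually.of_forall fun s hs => norm_scaledIntegrand_le ν hy (le_of_lt hs))

theorem tendsto_volterra_zero {f : ℝ → ℂ} (hf : Admissible f) :
    Tendsto (volterra f) (𝓝[>] 0) (𝓝 0) := by
  obtain ⟨C, hC, h⟩ := hf.bdd 1
  have hs : Tendsto (fun y : ℝ => C / 2 * y) (𝓝[>] 0) (𝓝 0) := by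
    have : Continuous fun y : ℝ => C / 2 * y := by fun_prop
    simpa using (this.tendsto 0).mono_left (nhdsWithin_le_nhds (s := Ioi 0))
  refine squeeze_zero_norm' ?_ hs
  filter_upwards [Ioc_mem_nhdsGT one_pos] with y hy
  simpa using norm_volterra_le (C := C) 0 hy.1.le fun s hs => by
    simpa using h s ⟨hs.1, hs.2.trans hy.2⟩

theorem besselFlux_eq_integral (ν : ℂ) {y : ℝ} (hy : 0 < y) :
    besselFlux ν y = ∫ s in (0 : ℝ)..y,
      ((Real.exp (-2 / s) : ℝ) : ℂ) * ((ν ^ 2 - 1 / 4) * besselRatio ν s) := by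
  have hadm := Admissible.exp_neg_two_div.mul
    ((Admissible.const (ν ^ 2 - 1 / 4)).mul (admissible_besselRatio ν))
  rw [intervalIntegral.integral_eq_sub_of_hasDerivAt_of_tendsto hy
    (fun s hs => hasDerivAt_besselFlux ν hs.1) (hadm.intervalIntegrable hy.le)
    (tendsto_besselFlux ν)
    ((hasDerivAt_besselFlux ν hy).continuousAt.tendsto.mono_left nhdsWithin_le_nhds), sub_zero]

theorem hasDerivAt_besselRatio' (ν : ℂ) {y : ℝ} (hy : 0 < y) :
    HasDerivAt (besselRatio ν)
      (volterraDeriv (fun s => (ν ^ 2 - 1 / 4) * besselRatio ν s) y) y := by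
  refine (hasDerivAt_besselRatio ν hy).congr_deriv ?_
  rw [volterraDeriv, ← besselFlux_eq_integral ν hy, besselFlux]
  have hexp : Real.exp (2 / y) * Real.exp (-(1 / y)) = Real.exp (1 / y) := by
    rw [← Real.exp_add]
    congr 1
    ring
  have hy' : (y : ℂ) ≠ 0 := by exact_mod_cast hy.ne'
  rw [← hexp]
  push_cast
  field_simp

/-- `besselRatio ν` is a multiple of the Neumann sum with constant potential `ν² - 1/4`. -/
theorem besselRatio_eq_neumannSum (ν : ℂ) {y : ℝ} (hy : 0 < y) :
    besselRatio ν y = (√(Real.pi / 2) : ℝ) * neumannSum (fun _ => ν ^ 2 - 1 / 4) y := by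
  have hadm := (Admissible.const (ν ^ 2 - 1 / 4)).mul (admissible_besselRatio ν)
  refine eq_const_mul_neumannSum (Admissible.const _) (admissible_besselRatio ν) _ ?_ hy
  intro x hx
  -- Both sides have the same derivative, so their difference is constant; its limit at $0$ is
  -- $\sqrt{\pi/2}$.
  have hder : ∀ u, 0 < u → HasDerivAt (fun u => besselRatio ν u -
      volterra (fun s => (ν ^ 2 - 1 / 4) * besselRatio ν s) u) 0 u := fun u hu =>
    ((hasDerivAt_besselRatio' ν hu).sub (hasDerivAt_volterra hadm hu)).congr_deriv (sub_self _)
  have hconst : ∀ u, 0 < u → besselRatio ν u -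
      volterra (fun s => (ν ^ 2 - 1 / 4) * besselRatio ν s) u = besselRatio ν x -
      volterra (fun s => (ν ^ 2 - 1 / 4) * besselRatio ν s) x := fun u hu =>
    isOpen_Ioi.is_const_of_deriv_eq_zero isPreconnected_Ioi
      (fun u hu => (hder u hu).differentiableAt.differentiableWithinAt)
      (fun u hu => (hder u hu).deriv) hu hx
  have hlim := (tendsto_besselRatio ν).sub (tendsto_volterra_zero hadm)
  have hlim' := tendsto_nhds_unique hlim (tendsto_const_nhds.congr' (by
    filter_upwards [self_mem_nhdsWithin] with u hu using (hconst u hu).symm))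
  rw [sub_zero] at hlim'
  rw [hlim']
  ring

/-! ### Comparison of two potentials near the singular point -/

theorem neumannSum_sub_eq {q₁ q₂ : ℝ → ℂ} (h1 : Admissible q₁) (h2 : Admissible q₂) {y : ℝ}
    (hy : 0 < y) :
    neumannSum q₁ y - neumannSum q₂ y = volterra (fun s =>
      q₂ s * (neumannSum q₁ s - neumannSum q₂ s) + (q₁ s - q₂ s) * neumannSum q₁ s) y := by
  have h := volterra_sub (h1.mul h1.neumannSum) (h2.mul h2.neumannSum) hy.le
  nth_rw 1 [neumannSum_eq h1 hy, neumannSum_eq h2 hy]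
  rw [add_sub_add_left_eq_sub, ← h]
  congr 1
  funext s
  ring

/-- If two potentials differ by `O(y²)`, the Neumann sums differ by `O(y³)`. -/
theorem exists_norm_neumannSum_sub_le {q₁ q₂ : ℝ → ℂ} (h1 : Admissible q₁) (h2 : Admissible q₂)
    {Y : ℝ} (hY : 0 ≤ Y) (h : ∀ s ∈ Ioc 0 Y, ‖q₁ s - q₂ s‖ ≤ s ^ 2) :
    ∃ C : ℝ, ∀ y ∈ Ioc 0 Y, ‖neumannSum q₁ y - neumannSum q₂ y‖ ≤ C * y ^ 3 := by
  obtain ⟨B, hB, hqB⟩ := h2.bdd Y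
  obtain ⟨W, hW, hwW⟩ := h1.neumannSum.bdd Y
  -- Bootstrap: each pass through the integral equation gains one power of $y$. The restriction `j ≤
  -- 2` reflects the forcing term of size $y^2$, which integrates to $y^3$.
  have step : ∀ j : ℕ, j ≤ 2 → (∃ M : ℝ, 0 ≤ M ∧ ∀ y ∈ Ioc 0 Y,
      ‖neumannSum q₁ y - neumannSum q₂ y‖ ≤ M * y ^ j) → ∃ M : ℝ, 0 ≤ M ∧ ∀ y ∈ Ioc 0 Y,
      ‖neumannSum q₁ y - neumannSum q₂ y‖ ≤ M * y ^ (j + 1) := by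
    rintro j hj ⟨M, hM, hMle⟩
    refine ⟨(B * M + Y ^ (2 - j) * W) / 2, by positivity, fun y hy => ?_⟩
    rw [neumannSum_sub_eq h1 h2 hy.1]
    refine (norm_volterra_le (C := B * M + Y ^ (2 - j) * W) j hy.1.le fun s hs => ?_).trans ?_
    · have hs' : s ∈ Ioc 0 Y := ⟨hs.1, hs.2.trans hy.2⟩
      have hs0 : 0 ≤ s := hs.1.le
      have a1 : ‖q₂ s * (neumannSum q₁ s - neumannSum q₂ s)‖ ≤ B * (M * s ^ j) := by
        rw [norm_mul]
        exact mul_le_mul (hqB s hs') (hMle s hs') (norm_nonneg _) hB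
      have a2 : ‖(q₁ s - q₂ s) * neumannSum q₁ s‖ ≤ s ^ 2 * W := by
        rw [norm_mul]
        exact mul_le_mul (h s hs') (hwW s hs') (norm_nonneg _) (by positivity)
      have a3 : s ^ 2 ≤ Y ^ (2 - j) * s ^ j := by
        rw [← pow_sub_mul_pow s hj]
        have := hs'.2
        gcongr
      calc _ ≤ B * (M * s ^ j) + s ^ 2 * W := norm_add_le_of_le a1 a2
        _ ≤ B * (M * s ^ j) + Y ^ (2 - j) * s ^ j * W := by gcongr
        _ = _ := by ring
    · have hy0 : 0 ≤ y := hy.1.le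
      gcongr
      exact div_le_self (by positivity) (by linarith [(Nat.cast_nonneg j : (0 : ℝ) ≤ j)])
  have h0 : ∃ M : ℝ, 0 ≤ M ∧ ∀ y ∈ Ioc 0 Y,
      ‖neumannSum q₁ y - neumannSum q₂ y‖ ≤ M * y ^ 0 := by
    obtain ⟨M, hM, hle⟩ := (h1.neumannSum.sub h2.neumannSum).bdd Y
    exact ⟨M, hM, fun y hy => by simpa using hle y hy⟩
  obtain ⟨C, -, hC⟩ := step 2 le_rfl (step 1 one_le_two (step 0 (Nat.zero_le 2) h0))
  exact ⟨C, hC⟩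

/-! ### The recessive solution of the modified Mathieu equation -/

/-- The Liouville–Green factor `e^{-e^x} e^{-x/2}`. -/
def recessiveFactor (x : ℝ) : ℝ := Real.exp (-Real.exp x) * Real.exp (-x / 2)

theorem recessiveFactor_pos (x : ℝ) : 0 < recessiveFactor x := by
  unfold recessiveFactor
  positivity

/-- The potential in the Volterra equation for the modified Mathieu equation. -/
def mathieuPotential (lam : ℂ) (s : ℝ) : ℂ := ((s : ℂ) ^ 2 - 1 / 4) - lam

theorem admissible_sq_sub : Admissible fun s : ℝ => (s : ℂ) ^ 2 - 1 / 4 :=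
  Admissible.of_continuous (by fun_prop)

theorem admissible_mathieuPotential (lam : ℂ) : Admissible (mathieuPotential lam) :=
  admissible_sq_sub.sub (Admissible.const lam)

/-- The solution of the modified Mathieu equation that is recessive at `+∞`. -/
def mathieuRecessive (x : ℝ) (lam : ℂ) : ℂ :=
  ((√(Real.pi / 2) * recessiveFactor x : ℝ) : ℂ) *
    neumannSum (mathieuPotential lam) (Real.exp (-x))

theorem besselK_exp_eq (ν : ℂ) (x : ℝ) :
    besselK ν (Real.exp x) = (recessiveFactor x : ℂ) * besselRatio ν (Real.exp (-x)) := by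
  have h1 : √(Real.exp (-x)) = Real.exp (-x / 2) := by
    rw [← Real.exp_half]
  have h2 : 1 / Real.exp (-x) = Real.exp x := by rw [Real.exp_neg, one_div, inv_inv]
  rw [besselRatio, h1, h2, besselMoment_zero, recessiveFactor, ← mul_assoc, ← Complex.ofReal_mul]
  have h3 : Real.exp (-Real.exp x) * Real.exp (-x / 2) *
      ((Real.exp (-x / 2))⁻¹ * Real.exp (Real.exp x)) = 1 := by
    rw [Real.exp_neg]
    field_simp
  rw [h3, Complex.ofReal_one, one_mul]

theorem mathieuRecessive_sub_besselK (lam ν : ℂ) (x : ℝ) :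
    mathieuRecessive x lam - besselK ν (Real.exp x) =
      ((√(Real.pi / 2) * recessiveFactor x : ℝ) : ℂ) *
        (neumannSum (mathieuPotential lam) (Real.exp (-x)) -
          neumannSum (fun _ => ν ^ 2 - 1 / 4) (Real.exp (-x))) := by
  rw [besselK_exp_eq, besselRatio_eq_neumannSum ν (Real.exp_pos _), mathieuRecessive]
  push_cast
  ring

theorem hasDerivAt_recessiveFactor (x : ℝ) :
    HasDerivAt recessiveFactor (recessiveFactor x * (-Real.exp x - 1 / 2)) x := by
  refine ((Real.hasDerivAt_exp x).neg.exp.mul (((hasDerivAt_id x).neg.div_const 2).exp)).congr_deriv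
    ?_
  simp only [recessiveFactor, Pi.neg_apply, id]
  ring

theorem hasDerivAt_exp_neg (x : ℝ) :
    HasDerivAt (fun x : ℝ => Real.exp (-x)) (-Real.exp (-x)) x := by
  simpa using (hasDerivAt_id x).neg.exp

theorem isModifiedMathieuSolution_mathieuRecessive (lam : ℂ) :
    IsModifiedMathieuSolution lam fun x => mathieuRecessive x lam := by
  set q := mathieuPotential lam with hq
  have hadm : Admissible q := admissible_mathieuPotential lam
  set c : ℝ := √(Real.pi / 2)
  set W : ℝ → ℂ := fun x => neumannSum q (Real.exp (-x)) with hW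
  set P : ℝ → ℂ := fun x => volterraDeriv (fun s => q s * neumannSum q s) (Real.exp (-x)) with hP
  have dW : ∀ x, HasDerivAt W (-(Real.exp (-x) : ℂ) * P x) x := fun x => by
    refine ((hasDerivAt_neumannSum hadm (Real.exp_pos (-x))).scomp x
      (hasDerivAt_exp_neg x)).congr_deriv ?_
    rw [Complex.real_smul]
    push_cast
    rfl
  have dP : ∀ x, HasDerivAt P (-(Real.exp (-x) : ℂ) * ((q (Real.exp (-x)) * W x -
      (2 * Real.exp (-x) + 2 : ℝ) * P x) / (Real.exp (-x) : ℂ) ^ 2)) x := fun x => by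
    refine ((hasDerivAt_volterraDeriv (hadm.mul hadm.neumannSum) (Real.exp_pos (-x))).scomp x
      (hasDerivAt_exp_neg x)).congr_deriv ?_
    rw [Complex.real_smul, Complex.ofReal_neg]
  have d1 : ∀ x, HasDerivAt (fun x => mathieuRecessive x lam) (((c * recessiveFactor x : ℝ) : ℂ) *
      (((-Real.exp x - 1 / 2 : ℝ) : ℂ) * W x - (Real.exp (-x) : ℂ) * P x)) x := fun x => by
    refine ((((hasDerivAt_recessiveFactor x).const_mul c).ofReal_comp).mul (dW x)).congr_deriv ?_
    push_cast
    ring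
  have d2 : ∀ x, HasDerivAt (fun x => ((c * recessiveFactor x : ℝ) : ℂ) *
      (((-Real.exp x - 1 / 2 : ℝ) : ℂ) * W x - (Real.exp (-x) : ℂ) * P x))
      ((((2 * Real.cosh (2 * x) : ℝ) : ℂ) - lam) * mathieuRecessive x lam) x := fun x => by
    have e1 := (((hasDerivAt_recessiveFactor x).const_mul c).ofReal_comp)
    have e2 := (((Real.hasDerivAt_exp x).neg.sub_const (1 / 2)).ofReal_comp.mul (dW x))
    have e3 := (hasDerivAt_exp_neg x).ofReal_comp.mul (dP x)
    refine (e1.mul (e2.sub e3)).congr_deriv ?_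
    have hE : (Real.exp x : ℂ) ≠ 0 := by exact_mod_cast (Real.exp_pos x).ne'
    have hcosh : ((2 * Real.cosh (2 * x) : ℝ) : ℂ) =
        (Real.exp x : ℂ) ^ 2 + ((Real.exp x : ℂ)⁻¹) ^ 2 := by
      have : 2 * Real.cosh (2 * x) = Real.exp x ^ 2 + (Real.exp x)⁻¹ ^ 2 := by
        rw [Real.cosh_eq, ← Real.exp_neg, ← Real.exp_nat_mul, ← Real.exp_nat_mul]
        push_cast
        ring_nf
      exact_mod_cast congrArg Complex.ofReal this
    have hm : mathieuRecessive x lam = ((c * recessiveFactor x : ℝ) : ℂ) * W x := rfl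
    have hqx : q (Real.exp (-x)) = (((Real.exp x)⁻¹ : ℝ) : ℂ) ^ 2 - 1 / 4 - lam := by
      rw [hq, mathieuPotential, Real.exp_neg]
    rw [hcosh, hm, hqx]
    simp only [Pi.neg_apply, Pi.mul_apply, Pi.sub_apply, Real.exp_neg, Complex.ofReal_mul,
      Complex.ofReal_sub, Complex.ofReal_neg, Complex.ofReal_add, Complex.ofReal_inv,
      Complex.ofReal_div, Complex.ofReal_one, Complex.ofReal_ofNat]
    generalize (Real.exp x : ℂ) = E at hE
    field_simp
    ring
  have hd1 : deriv (fun x => mathieuRecessive x lam) = _ := funext fun x => (d1 x).deriv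
  have hd2 : deriv (deriv fun x => mathieuRecessive x lam) = _ :=
    hd1 ▸ funext fun x => (d2 x).deriv
  refine ⟨?_, fun x => ?_⟩
  · have hcont : Continuous fun x => mathieuRecessive x lam :=
      continuous_iff_continuousAt.2 fun x => (d1 x).continuousAt
    rw [show (2 : WithTop ℕ∞) = 1 + 1 by norm_num, contDiff_succ_iff_deriv]
    refine ⟨fun x => (d1 x).differentiableAt, by simp, ?_⟩
    rw [contDiff_one_iff_deriv]
    refine ⟨?_, ?_⟩
    · rw [hd1]
      exact fun x => (d2 x).differentiableAt
    · rw [hd2]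
      fun_prop
  · rw [hd2]
    ring

theorem exists_norm_mathieuRecessive_sub_besselK_le (lam ν : ℂ) (h : ν ^ 2 = -lam) (a : ℝ) :
    ∃ C : ℝ, ∀ x : ℝ, a ≤ x → ‖mathieuRecessive x lam - besselK ν (Real.exp x)‖ ≤
      C * Real.exp (-Real.exp x) * Real.exp (-(7 / 2) * x) := by
  obtain ⟨C, hC⟩ := exists_norm_neumannSum_sub_le (admissible_mathieuPotential lam)
    (Admissible.const (ν ^ 2 - 1 / 4)) (Real.exp_pos (-a)).le (fun s _ => by
      rw [h, mathieuPotential, show (s : ℂ) ^ 2 - 1 / 4 - lam - (-lam - 1 / 4) = (s : ℂ) ^ 2 by ring,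
        norm_pow, Complex.norm_real, Real.norm_eq_abs, sq_abs])
  refine ⟨√(Real.pi / 2) * C, fun x hx => ?_⟩
  have hx' := hC (Real.exp (-x)) ⟨Real.exp_pos _, Real.exp_le_exp.2 (neg_le_neg hx)⟩
  have hp := recessiveFactor_pos x
  rw [mathieuRecessive_sub_besselK, norm_mul, Complex.norm_real,
    Real.norm_of_nonneg (by positivity)]
  refine (mul_le_mul_of_nonneg_left hx' (by positivity)).trans (le_of_eq ?_)
  have : Real.exp (-x / 2) * Real.exp (-x) ^ 3 = Real.exp (-(7 / 2) * x) := by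
    rw [← Real.exp_nat_mul, ← Real.exp_add]
    congr 1
    push_cast
    ring
  rw [← this, recessiveFactor]
  ring

/-- The error is $e^{-3x}$ times the Liouville–Green factor, while $K_\nu(e^x)$ is eventually at
least $\tfrac12\sqrt{\pi/2}$ times that factor in norm. -/
theorem isEquivalent_mathieuRecessive_besselK (lam ν : ℂ) (h : ν ^ 2 = -lam) :
    Asymptotics.IsEquivalent atTop (fun x => mathieuRecessive x lam)
      (fun x => besselK ν (Real.exp x)) := by
  have hlim : Tendsto (fun x : ℝ => Real.exp (-x)) atTop (𝓝[>] 0) :=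
    tendsto_nhdsWithin_iff.2 ⟨Real.tendsto_exp_neg_atTop_nhds_zero,
      Eventually.of_forall fun x => Real.exp_pos _⟩
  have hc : 0 < √(Real.pi / 2) := Real.sqrt_pos.2 (by positivity)
  have hv := (tendsto_besselRatio ν).comp hlim
  obtain ⟨C, hC⟩ := exists_norm_mathieuRecessive_sub_besselK_le lam ν h 0
  have hv' : ∀ᶠ x : ℝ in atTop, √(Real.pi / 2) / 2 < ‖besselRatio ν (Real.exp (-x))‖ := by
    refine hv.norm.eventually_const_lt ?_
    rw [Complex.norm_real, Real.norm_of_nonneg hc.le]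
    linarith
  refine Asymptotics.IsBigO.trans_isLittleO (g := fun x : ℝ => recessiveFactor x * Real.exp (-3 * x))
    (Asymptotics.IsBigO.of_bound C ?_) ?_
  · filter_upwards [eventually_ge_atTop 0] with x hx
    refine (hC x hx).trans (le_of_eq ?_)
    have hp := recessiveFactor_pos x
    rw [Real.norm_of_nonneg (by positivity), recessiveFactor,
      show -(7 / 2) * x = -x / 2 + -3 * x by ring, Real.exp_add]
    ring
  · have h3 : Tendsto (fun x : ℝ => Real.exp (-3 * x)) atTop (𝓝 0) :=
      Real.tendsto_exp_atBot.comp (tendsto_id.const_mul_atTop_of_neg (by norm_num))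
    refine Asymptotics.IsLittleO.of_bound fun ε hε => ?_
    filter_upwards [hv', h3.eventually_lt_const
      (show 0 < ε * (√(Real.pi / 2) / 2) by positivity)] with x hx hx3
    have hp := recessiveFactor_pos x
    rw [Real.norm_of_nonneg (by positivity), besselK_exp_eq, norm_mul, Complex.norm_real,
      Real.norm_of_nonneg hp.le]
    calc recessiveFactor x * Real.exp (-3 * x)
        ≤ recessiveFactor x * (ε * (√(Real.pi / 2) / 2)) := by gcongr
      _ ≤ recessiveFactor x * (ε * ‖besselRatio ν (Real.exp (-x))‖) := by gcongr
      _ = _ := by ring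

/-! ### Growth in the spectral parameter -/

/-- Half of the exponent $z\cosh t$ absorbs $e^{nt}$; the other half is integrable with a bound `M`
independent of `n`. -/
theorem norm_besselK_nat_le {z : ℝ} (hz : 0 < z) :
    ∃ M : ℝ, 0 ≤ M ∧ ∀ n : ℕ, ‖besselK n z‖ ≤ n.factorial * (4 / z) ^ n * M := by
  have hint : IntegrableOn (fun t : ℝ => Real.exp (-(z / 2 * Real.cosh t))) (Ioi 0) := by
    obtain ⟨C, hC⟩ := exists_besselIntegrand_le (half_pos hz) 0 0
    refine integrableOn_of_norm_le_exp_neg (by fun_prop) (C := C) fun t ht => ?_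
    simpa using hC t ht
  refine ⟨∫ t in Ioi (0 : ℝ), Real.exp (-(z / 2 * Real.cosh t)),
    setIntegral_nonneg measurableSet_Ioi fun t _ => by positivity, fun n => ?_⟩
  rw [← besselMoment_zero, ← integral_const_mul]
  refine norm_integral_le_of_norm_le (hint.const_mul _) ?_
  refine (ae_restrict_iff' measurableSet_Ioi).2 (Eventually.of_forall fun t ht => ?_)
  refine (norm_besselIntegrand_le 0 n z (le_of_lt ht)).trans ?_
  rw [pow_zero, one_mul, Complex.norm_natCast]
  have h := exp_nat_mul_le (half_pos hz) n t
  rw [show 2 / (z / 2) = 4 / z by field_simp; norm_num] at h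
  calc Real.exp (-(z * Real.cosh t)) * Real.exp (n * t)
      ≤ Real.exp (-(z * Real.cosh t)) *
        (n.factorial * (4 / z) ^ n * Real.exp (z / 2 * Real.cosh t)) := by gcongr
    _ = n.factorial * (4 / z) ^ n *
        (Real.exp (-(z * Real.cosh t)) * Real.exp (z / 2 * Real.cosh t)) := by ring
    _ = _ := by
      rw [← Real.exp_add]
      ring_nf

/-- The integrand is positive, so it suffices to integrate over $(1,2]$, where $\cosh nt\ge e^n/2$.
-/
theorem le_norm_besselK_nat {z : ℝ} (hz : 0 < z) (n : ℕ) :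
    Real.exp (-(z * Real.cosh 2)) / 2 * Real.exp n ≤ ‖besselK n z‖ := by
  set f : ℝ → ℝ := fun t => Real.exp (-(z * Real.cosh t)) * Real.cosh (n * t) with hf
  have e : besselIntegrand 0 n z = fun t => (f t : ℂ) := by
    funext t
    simp only [besselIntegrand, hf]
    push_cast
    ring
  have hint : IntegrableOn f (Ioi 0) := by
    have := (integrableOn_besselIntegrand 0 n hz).re
    simp only [e] at this
    exact this
  have hpos : ∀ t, 0 ≤ f t := fun t => mul_nonneg (Real.exp_pos _).le (Real.cosh_pos _).le
  have hK : besselK n z = ((∫ t in Ioi (0 : ℝ), f t : ℝ) : ℂ) := by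
    rw [← besselMoment_zero, besselMoment, e]
    exact integral_ofReal
  rw [hK, Complex.norm_real, Real.norm_of_nonneg (integral_nonneg hpos)]
  have hsub : Ioc (1 : ℝ) 2 ⊆ Ioi 0 := fun t ht => lt_trans one_pos ht.1
  refine le_trans ?_ (setIntegral_mono_set hint (Eventually.of_forall hpos)
    (LE.le.eventuallyLE hsub))
  have hconst : ∫ _ in Ioc (1 : ℝ) 2, Real.exp (-(z * Real.cosh 2)) / 2 * Real.exp n =
      Real.exp (-(z * Real.cosh 2)) / 2 * Real.exp n := by
    rw [setIntegral_const]
    norm_num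
  rw [← hconst]
  refine setIntegral_mono_on continuous_const.integrableOn_Ioc (hint.mono_set hsub) measurableSet_Ioc fun t ht => ?_
  have h1 : Real.cosh t ≤ Real.cosh 2 := by
    rw [Real.cosh_le_cosh, abs_of_pos (by linarith [ht.1]), abs_of_pos two_pos]
    exact ht.2
  have h2 : Real.exp n / 2 ≤ Real.cosh (n * t) := by
    rw [Real.cosh_eq]
    have := Real.exp_pos (-(n * t))
    have : Real.exp n ≤ Real.exp (n * t) :=
      Real.exp_le_exp.2 (le_mul_of_one_le_right (Nat.cast_nonneg n) ht.1.le)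
    linarith
  calc Real.exp (-(z * Real.cosh 2)) / 2 * Real.exp n
      = Real.exp (-(z * Real.cosh 2)) * (Real.exp n / 2) := by ring
    _ ≤ _ := by
      simp only [hf]
      gcongr

theorem norm_besselK_nat_eq (n : ℕ) (x : ℝ) :
    ‖besselK n (Real.exp x)‖ = √(Real.pi / 2) * recessiveFactor x *
      ‖neumannSum (fun _ => (((n : ℝ) ^ 2 - 1 / 4 : ℝ) : ℂ)) (Real.exp (-x))‖ := by
  rw [besselK_exp_eq, besselRatio_eq_neumannSum _ (Real.exp_pos _), norm_mul, norm_mul,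
    Complex.norm_real, Complex.norm_real, Real.norm_of_nonneg (recessiveFactor_pos x).le,
    Real.norm_of_nonneg (Real.sqrt_nonneg _)]
  push_cast
  ring

theorem norm_mathieuRecessive (x : ℝ) (lam : ℂ) :
    ‖mathieuRecessive x lam‖ = √(Real.pi / 2) * recessiveFactor x *
      ‖neumannSum (mathieuPotential lam) (Real.exp (-x))‖ := by
  have := recessiveFactor_pos x
  rw [mathieuRecessive, norm_mul, Complex.norm_real, Real.norm_of_nonneg (by positivity)]

theorem norm_mathieuRecessive_le {x : ℝ} {lam : ℂ} {n : ℕ}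
    (h : ‖lam‖ + Real.exp (-x) ^ 2 + 1 ≤ (n : ℝ) ^ 2) :
    ‖mathieuRecessive x lam‖ ≤ ‖besselK n (Real.exp x)‖ := by
  rw [norm_mathieuRecessive, norm_besselK_nat_eq]
  have := recessiveFactor_pos x
  refine mul_le_mul_of_nonneg_left ?_ (by positivity)
  refine norm_neumannSum_le (q₂ := fun _ => (n : ℝ) ^ 2 - 1 / 4) (Admissible.const _)
    (Real.exp_pos _) fun s hs => ?_
  have h1 : ‖(s : ℂ) ^ 2‖ ≤ Real.exp (-x) ^ 2 := by
    rw [norm_pow, Complex.norm_real, Real.norm_of_nonneg hs.1.le]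
    exact pow_le_pow_left₀ hs.1.le hs.2 2
  have h2 : ‖(1 / 4 : ℂ)‖ ≤ 1 / 4 := by norm_num
  have h3 : ‖mathieuPotential lam s‖ ≤ Real.exp (-x) ^ 2 + 1 / 4 + ‖lam‖ :=
    norm_sub_le_of_le (norm_sub_le_of_le h1 h2) le_rfl
  linarith

/-- At $\lambda=-n^2$ the Mathieu potential is $s^2+n^2-\tfrac14$, which dominates the positive
Bessel potential $n^2-\tfrac14$. -/
theorem le_norm_mathieuRecessive (x : ℝ) {n : ℕ} (hn : 1 ≤ n) :
    ‖besselK n (Real.exp x)‖ ≤ ‖mathieuRecessive x (-(n : ℂ) ^ 2)‖ := by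
  rw [norm_mathieuRecessive, norm_besselK_nat_eq]
  have := recessiveFactor_pos x
  refine mul_le_mul_of_nonneg_left ?_ (by positivity)
  have e : mathieuPotential (-(n : ℂ) ^ 2) = fun s : ℝ => ((s ^ 2 - 1 / 4 + (n : ℝ) ^ 2 : ℝ) : ℂ) := by
    funext s
    simp only [mathieuPotential]
    push_cast
    ring
  rw [e]
  refine norm_neumannSum_le (Admissible.of_continuous (by fun_prop)) (Real.exp_pos _)
    fun s _ => ?_
  have hn' : (1 : ℝ) ≤ n := by exact_mod_cast hn
  rw [Complex.norm_real, Real.norm_of_nonneg (by nlinarith)]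
  nlinarith [sq_nonneg s]

theorem eventually_log_growth {s : ℝ} (hs : 1 / 2 < s) (b : ℝ) (hb : 0 < b) :
    ∀ᶠ r : ℝ in atTop, 3 * √r * Real.log (b * (3 * √r)) ≤ r ^ s := by
  have hs' : 0 < s - 1 / 2 := by linarith
  -- After division by $\sqrt r$ the left side is $3\log(3b)+\tfrac32\log r$. The constants `1 / 3`
  -- and `6` make each summand at most $\tfrac12r^{s-1/2}$.
  have h1 := (isLittleO_log_rpow_atTop hs').bound (show (0 : ℝ) < 1 / 3 by norm_num)
  have h2 := (tendsto_rpow_atTop hs').eventually_ge_atTop (6 * Real.log (b * 3))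
  filter_upwards [h1, h2, eventually_ge_atTop 1] with r h1 h2 hr
  have hr0 : 0 < r := by linarith
  have hsq := Real.sqrt_pos.2 hr0
  rw [Real.norm_of_nonneg (Real.log_nonneg hr), Real.norm_of_nonneg (by positivity)] at h1
  rw [← mul_assoc b, Real.log_mul (by positivity) hsq.ne', Real.log_sqrt hr0.le]
  have e : r ^ s = √r * r ^ (s - 1 / 2) := by
    rw [Real.sqrt_eq_rpow, ← Real.rpow_add hr0]
    congr 1
    ring
  rw [e, mul_comm 3 (√r), mul_assoc]
  refine mul_le_mul_of_nonneg_left ?_ hsq.le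
  linarith

theorem mathieuRecessive_isBigO (x : ℝ) {s : ℝ} (hs : 1 / 2 < s) :
    (fun lam => mathieuRecessive x lam) =O[Bornology.cobounded ℂ]
      fun z : ℂ => Real.exp (‖z‖ ^ s) := by
  obtain ⟨M, hM, hK⟩ := norm_besselK_nat_le (Real.exp_pos x)
  set b : ℝ := max (4 / Real.exp x) 1 with hb
  have hb1 : 1 ≤ b := le_max_right _ _
  refine Asymptotics.IsBigO.of_bound M ?_
  have hev : ∀ᶠ r : ℝ in atTop, 3 * √r * Real.log (b * (3 * √r)) ≤ r ^ s ∧ 1 ≤ r ∧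
      Real.exp (-x) ^ 2 + 1 ≤ r :=
    (eventually_log_growth hs b (by linarith)).and
      ((eventually_ge_atTop _).and (eventually_ge_atTop _))
  filter_upwards [tendsto_norm_cobounded_atTop.eventually hev] with lam ⟨hlog, h1, hA⟩
  set r := ‖lam‖
  -- The least integer meeting the comparison hypothesis; for large `r` it is at most
  -- $\sqrt{2r}+1\le3\sqrt r$.
  set n := ⌈√(r + (Real.exp (-x) ^ 2 + 1))⌉₊ with hn
  have hn1 : √(r + (Real.exp (-x) ^ 2 + 1)) ≤ n := Nat.le_ceil _
  have hnsq : r + Real.exp (-x) ^ 2 + 1 ≤ (n : ℝ) ^ 2 := by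
    have := Real.sqrt_le_left (Nat.cast_nonneg n) |>.1 hn1
    linarith
  have hsq1 : 1 ≤ √r := Real.one_le_sqrt.2 h1
  have hn3 : (n : ℝ) ≤ 3 * √r := by
    have h2 : (n : ℝ) < √(r + (Real.exp (-x) ^ 2 + 1)) + 1 := Nat.ceil_lt_add_one (Real.sqrt_nonneg _)
    have h3 : √(r + (Real.exp (-x) ^ 2 + 1)) ≤ 2 * √r := by
      rw [Real.sqrt_le_left (by positivity), mul_pow, Real.sq_sqrt (by linarith)]
      linarith
    linarith
  have hn0 : (1 : ℝ) ≤ n := by nlinarith [sq_nonneg (Real.exp (-x)), (Nat.cast_nonneg n : (0 : ℝ) ≤ n)]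
  rw [Real.norm_of_nonneg (Real.exp_pos _).le, mul_comm M]
  refine (norm_mathieuRecessive_le hnsq).trans ((hK n).trans (mul_le_mul_of_nonneg_right ?_ hM))
  calc (n.factorial : ℝ) * (4 / Real.exp x) ^ n ≤ (n : ℝ) ^ n * b ^ n := by
        have : (n.factorial : ℝ) ≤ (n : ℝ) ^ n := by exact_mod_cast Nat.factorial_le_pow n
        have := le_max_left (4 / Real.exp x) 1
        gcongr
    _ = (b * n) ^ n := by rw [mul_pow, mul_comm]
    _ = Real.exp (n * Real.log (b * n)) := by
        rw [Real.exp_nat_mul, Real.exp_log (by positivity)]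
    _ ≤ Real.exp (3 * √r * Real.log (b * (3 * √r))) := by
        have : 0 ≤ Real.log (b * n) := Real.log_nonneg (one_le_mul_of_one_le_of_one_le hb1 hn0)
        gcongr
    _ ≤ _ := Real.exp_le_exp.2 hlog

theorem half_le_of_mathieuRecessive_isBigO (x : ℝ) {s : ℝ}
    (h : (fun lam => mathieuRecessive x lam) =O[Bornology.cobounded ℂ]
      fun z : ℂ => Real.exp (‖z‖ ^ s)) : 1 / 2 ≤ s := by
  by_contra! hs
  have hnorm : ∀ n : ℕ, ‖-(n : ℂ) ^ 2‖ = (n : ℝ) ^ 2 := fun n => by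
    rw [norm_neg, norm_pow, Complex.norm_natCast]
  have hseq : Tendsto (fun n : ℕ => -(n : ℂ) ^ 2) atTop (Bornology.cobounded ℂ) := by
    rw [← tendsto_norm_atTop_iff_cobounded]
    simp only [hnorm]
    exact (tendsto_pow_atTop two_ne_zero).comp tendsto_natCast_atTop_atTop
  obtain ⟨C, hC⟩ := (h.comp_tendsto hseq).bound
  set c := Real.exp (-(Real.exp x * Real.cosh 2)) / 2 with hc
  have hcpos : 0 < c := by positivity
  -- If $2s<1$, the assumed bound along $\lambda=-n^2$ gives $c\,e^n\le Ce^{n^{2s}}\le Ce^{n/2}$,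
  -- which fails for large $n$.
  have hlittle : ∀ᶠ n : ℕ in atTop, (n : ℝ) ^ (2 * s) ≤ n / 2 := by
    have h1 := (tendsto_rpow_neg_atTop (show 0 < 1 - 2 * s by linarith)).comp
      (tendsto_natCast_atTop_atTop (R := ℝ))
    filter_upwards [h1.eventually_le_const (show (0 : ℝ) < 1 / 2 by norm_num),
      eventually_ge_atTop 1] with n hn hn1
    have hn0 : (0 : ℝ) < n := by exact_mod_cast hn1
    simp only [Function.comp_apply] at hn
    calc (n : ℝ) ^ (2 * s) = n * (n : ℝ) ^ (-(1 - 2 * s)) := by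
          nth_rw 1 [show 2 * s = 1 + -(1 - 2 * s) by ring]
          rw [Real.rpow_add hn0, Real.rpow_one]
      _ ≤ n * (1 / 2) := by gcongr
      _ = _ := by ring
  have hexp : Tendsto (fun n : ℕ => c * Real.exp ((n : ℝ) / 2)) atTop atTop :=
    (Real.tendsto_exp_atTop.comp
      (tendsto_natCast_atTop_atTop.atTop_div_const two_pos)).const_mul_atTop hcpos
  obtain ⟨n, hn, hle, hbig, hn1⟩ := (hC.and (hlittle.and
    ((hexp.eventually_gt_atTop C).and (eventually_ge_atTop 1)))).exists
  simp only [Function.comp_apply] at hn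
  rw [hnorm, Real.norm_of_nonneg (Real.exp_pos _).le] at hn
  have e : ((n : ℝ) ^ 2) ^ s = (n : ℝ) ^ (2 * s) := by
    rw [Real.rpow_mul (Nat.cast_nonneg n), Real.rpow_two]
  rw [e] at hn
  have hlow := (le_norm_besselK_nat (Real.exp_pos x) n).trans
    ((le_norm_mathieuRecessive x hn1).trans hn)
  rw [← hc] at hlow
  have hsplit : Real.exp (n : ℝ) = Real.exp ((n : ℝ) / 2) * Real.exp ((n : ℝ) / 2) := by
    rw [← Real.exp_add, add_halves]
  have hE := Real.exp_pos ((n : ℝ) / 2)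
  have hC0 : 0 ≤ C := by
    by_contra! hneg
    have := mul_neg_of_neg_of_pos hneg (Real.exp_pos ((n : ℝ) ^ (2 * s)))
    have := mul_pos hcpos (Real.exp_pos (n : ℝ))
    linarith
  have : C * Real.exp ((n : ℝ) ^ (2 * s)) ≤ C * Real.exp ((n : ℝ) / 2) := by gcongr
  rw [hsplit] at hlow
  nlinarith

theorem isEntireOfOrder_mathieuRecessive (x : ℝ) :
    IsEntireOfOrder (fun lam => mathieuRecessive x lam) (1 / 2) := by
  refine ⟨(differentiable_neumannSum admissible_sq_sub (Real.exp_pos (-x))).const_mul _,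
    fun s hs => half_le_of_mathieuRecessive_isBigO x hs.2, fun b hb => ?_⟩
  -- The exponent $1/2$ itself need not be admissible: the infimum is approached through all
  -- $s>1/2$.
  refine le_of_forall_gt_imp_ge_of_dense fun s hs => hb ⟨by linarith, mathieuRecessive_isBigO x hs⟩

end

theorem theorem2 :
    ∃ ψ : ℝ → ℂ → ℂ,
      (∀ lam : ℂ, IsModifiedMathieuSolution lam (fun x : ℝ => ψ x lam)) ∧
      (∀ lam k : ℂ, lam = k ^ 2 →
        Asymptotics.IsEquivalent Filter.atTop
          (fun x : ℝ => ψ x lam)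
          (fun x : ℝ => besselK (Complex.I * k) (Real.exp x))) ∧
      (∀ lam k : ℂ, lam = k ^ 2 → ∀ a : ℝ, ∃ C : ℝ, ∀ x : ℝ, a ≤ x →
        ‖ψ x lam - besselK (Complex.I * k) (Real.exp x)‖ ≤
          C * Real.exp (-Real.exp x) * Real.exp (-(7 / 2) * x)) ∧
      (∀ x : ℝ, IsEntireOfOrder (fun lam : ℂ => ψ x lam) (1 / 2)) := by
  have hk : ∀ lam k : ℂ, lam = k ^ 2 → (Complex.I * k) ^ 2 = -lam := fun lam k h => by
    rw [h, mul_pow, Complex.I_sq, neg_one_mul]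
  exact ⟨mathieuRecessive, isModifiedMathieuSolution_mathieuRecessive,
    fun lam k h => isEquivalent_mathieuRecessive_besselK lam _ (hk lam k h),
    fun lam k h a => exists_norm_mathieuRecessive_sub_besselK_le lam _ (hk lam k h) a,
    isEntireOfOrder_mathieuRecessive⟩
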